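/- **Setting.** Let $\Omega\subset\mathbb R^d$, $d\ge 1$, be a bounded polyhedral Lipschitz domain, $\Gamma_D\subseteq\partial\Omega$ closed (possibly empty), and let $\mathcal T_h$ be a conforming triangulation of $\overline\Omega$ into closed $d$-simplices such that $\Gamma_D$ is a union of sides ($(d-1)$-dimensional faces of elements). Let $\mathcal S_h$ and $\mathcal N_h$ be the sets of sides and vertices, $h_T=\operatorname{diam}T$, $h_S=\operatorname{diam}S$, $x_S$ the barycenter of $S\in\mathcal S_h$, and assume shape regularity $h_T\le\kappa\rho_T$ for all $T\in\mathcal T_h$, where $\rho_T$ is the diameter of the largest ball contained in $T$. For $T\in\mathcal T_h$ put $\omega_T=\bigcup\{T'\in\mathcal T_h: T'\cap T\ne\emptyset\}$ and $$\mathcal S_h(T)=\{S\in\mathcal S_h: S\cap\operatorname{int}(\omega_T)\neq\emptyset\}\cup\{S\in\mathcal S_h: S\subseteq\Gamma_D,\ S\cap T\ne\emptyset\}.$$ For element-wise defined $w$, the jump is $[\![w]\!]_S=w|_{T_+}-w|_{T_-}$ if $S$ is the common side of two elements $T_\pm$, and $[\![w]\!]_S=w|_T$ if $S\subseteq\partial\Omega$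 is a side of $T$; $\nabla_h^m$ denotes the element-wise $m$-th gradient. $\mathcal S^{1,cr}_D(\mathcal T_h)$ is the Crouzeix–Raviart space of element-wise affine $v_h$ with $\int_S[\![v_h]\!]_S\,ds=0$ for all $S\in\mathcal S_h$ with $S\not\subseteq\partial\Omega$ and $v_h(x_S)=0$ for all $S\in\mathcal S_h$ with $S\subseteq\Gamma_D$. The node-averaging operator is $\mathcal J_h^{av}v_h=\sum_{z\in\mathcal N_h}\langle v_h\rangle_z\varphi_z$, where $\varphi_z$ is the continuous, element-wise affine nodal basis function of $z$, $\langle v_h\rangle_z=0$ if $z\in\Gamma_D$, and otherwise $\langle v_h\rangle_z$ is the arithmetic mean of the values $(v_h|_T)(z)$ over all $T\in\mathcal T_h$ with $z\in T$. An N-function is a convex $\varphi:[0,\infty)\to[0,\infty)$ with $\varphi(0)=0$, $\varphi(t)>0$ for $t>0$, $\varphi(t)/t\to0$ as $t\to0$ and $\varphi(t)/t\to\infty$ as $t\to\infty$. Write $\varphi\in\Delta_2$ if $\varphi(2t)\le c\,\varphi(t)$ for all $t\ge0$ with some $c>0$, the smallest such $c$ being $\Delta_2(\varphi)$; write $\varphi\in\nabla_2$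 if the conjugate $\varphi^*(s)=\sup_{t\ge0}(st-\varphi(t))$ is an N-function in $\Delta_2$. With the right derivative $\varphi'$, the shifted N-functions are $\varphi_a(t)=\int_0^t\varphi'(a+s)\frac{s}{a+s}\,ds$ for $a,t\ge0$, and $c_\varphi=\sup_{a\ge0}\Delta_2(\varphi_a)$. **Claim.** Let $\varphi$ be an N-function with $\varphi\in\Delta_2\cap\nabla_2$. Then there are constants $c_{av},\tilde c_{av}>0$, depending only on $d$, $\kappa$ and an upper bound for $c_\varphi$ (in particular not on the mesh-sizes), such that for all $v_h\in\mathcal S^{1,cr}_D(\mathcal T_h)$, $m\in\{0,1,2\}$, $a\ge0$ and $T\in\mathcal T_h$, $$\frac1{|T|}\int_T\varphi_a\big(h_T^m|\nabla_h^m(v_h-\mathcal J_h^{av}v_h)|\big)\,dx\ \le\ c_{av}\sum_{S\in\mathcal S_h(T)}\frac1{|S|}\int_S\varphi_a\big(h_S|[\![\nabla_hv_h]\!]_S|\big)\,ds\ \le\ \frac{\tilde c_{av}}{|\omega_T|}\int_{\omega_T}\varphi_a\big(h_T|\nabla_hv_h|\big)\,dx ,$$ where $|S|$ and $ds$ refer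 to the $(d-1)$-dimensional Hausdorff measure. -/

import Mathlib

open MeasureTheory Set Filter Topology

noncomputable section

/-! ### N-functions (real functions of which only the values on `[0, ∞)` matter) -/

namespace NFun

/-- `φ : [0,∞) → [0,∞)` is an N-function. -/
structure IsNFunction (φ : ℝ → ℝ) : Prop where
  convexOn : ConvexOn ℝ (Ici 0) φ
  zero : φ 0 = 0
  pos : ∀ t, 0 < t → 0 < φ t
  lim_zero : Tendsto (fun t => φ t / t) (𝓝[>] 0) (𝓝 0)
  lim_top : Tendsto (fun t => φ t / t) atTop atTop

/-- The admissible constants in the `Δ₂`-condition for `φ`. -/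
def delta2Set (φ : ℝ → ℝ) : Set ℝ :=
  {c | 0 < c ∧ ∀ t, 0 ≤ t → φ (2 * t) ≤ c * φ t}

/-- The `Δ₂`-condition. -/
def IsDelta2 (φ : ℝ → ℝ) : Prop := (delta2Set φ).Nonempty

/-- The smallest constant `Δ₂(φ)` in the `Δ₂`-condition. -/
def delta2 (φ : ℝ → ℝ) : ℝ := sInf (delta2Set φ)

/-- The Fenchel conjugate `φ*(s) = sup_{t ≥ 0} (s t - φ(t))`. -/
def conj (φ : ℝ → ℝ) (s : ℝ) : ℝ := sSup ((fun t => s * t - φ t) '' Ici 0)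

/-- The `∇₂`-condition: the Fenchel conjugate is an N-function with the `Δ₂`-condition. -/
def IsNabla2 (φ : ℝ → ℝ) : Prop := IsNFunction (conj φ) ∧ IsDelta2 (conj φ)

/-- The right derivative `φ'`. -/
def rderiv (φ : ℝ → ℝ) (t : ℝ) : ℝ := derivWithin φ (Ioi t) t

/-- The shifted N-function `φ_a(t) = ∫₀ᵗ φ'(a+s) s/(a+s) ds`. -/
def shifted (φ : ℝ → ℝ) (a t : ℝ) : ℝ :=
  ∫ s in (0 : ℝ)..t, rderiv φ (a + s) * (s / (a + s))

/-- `c_φ = sup_{a ≥ 0} Δ₂(φ_a)`. -/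
def shiftConst (φ : ℝ → ℝ) : ℝ := sSup ((fun a => delta2 (shifted φ a)) '' Ici 0)

end NFun

namespace FEM

/-- `ℝᵈ` with the Euclidean norm. -/
abbrev E (d : ℕ) : Type := EuclideanSpace ℝ (Fin d)

/-- Bounded Lipschitz domain: a bounded, open, connected set which in a neighbourhood of each of
its boundary points is the strict epigraph of a Lipschitz function: with a suitable unit vector `n`
as the vertical direction, `⟪n, y⟫` is the height and `y - ⟪n, y⟫ n` the horizontal part of `y`. -/
structure IsLipschitzDomain {d : ℕ} (Ω : Set (E d)) : Prop where
  isOpen : IsOpen Ω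
  isConnected : IsConnected Ω
  isBounded : Bornology.IsBounded Ω
  lipschitz : ∀ x ∈ frontier Ω, ∃ (n : E d) (L : NNReal) (γ : E d → ℝ), ‖n‖ = 1 ∧
    LipschitzWith L γ ∧
    ∀ᶠ y in 𝓝 x, (y ∈ Ω ↔ γ (y - inner ℝ n y • n) < inner ℝ n y)

/-- A conforming triangulation of `Ω ⊆ ℝᵈ`: a finite simplicial complex, all of whose faces are
faces of `d`-simplices of the complex, and whose underlying space is the closure of `Ω`.
A simplex is given by the finite set of its vertices. -/
structure Triangulation {d : ℕ} (Ω : Set (E d)) extends Geometry.SimplicialComplex ℝ (E d) where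
  finite_faces : faces.Finite
  pure : ∀ s ∈ faces, ∃ t ∈ faces, s ⊆ t ∧ t.card = d + 1
  space_eq : toSimplicialComplex.space = closure Ω

namespace Triangulation

variable {d : ℕ} {Ω : Set (E d)} (𝒯 : Triangulation Ω)

/-- The elements `T ∈ 𝒯_h`, by their vertices. -/
abbrev Elem : Type := {T : Finset (E d) // T ∈ 𝒯.faces ∧ T.card = d + 1}

instance : Fintype 𝒯.Elem :=
  (𝒯.finite_faces.subset (fun _ hT => hT.1) :
    {T : Finset (E d) | T ∈ 𝒯.faces ∧ T.card = d + 1}.Finite).fintype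

/-- The closed simplex with the given vertices. -/
abbrev hull (s : Finset (E d)) : Set (E d) := convexHull ℝ (s : Set (E d))

open Classical in
/-- The set `𝒮_h` of the sides (faces of dimension `d - 1`) of the elements. -/
def sides : Finset (Finset (E d)) :=
  Finset.univ.biUnion fun T : 𝒯.Elem => T.1.powersetCard d

open Classical in
/-- The set `𝒩_h` of the vertices of the elements. -/
def nodes : Finset (E d) := Finset.univ.biUnion fun T : 𝒯.Elem => T.1

/-- `h_T` and `h_S`: the diameter of the closed simplex. -/
def meshSize (s : Finset (E d)) : ℝ := Metric.diam (hull s)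

/-- `ρ_T`: the diameter of the largest ball contained in the closed simplex. -/
def inballDiam (s : Finset (E d)) : ℝ :=
  sSup {δ : ℝ | 0 ≤ δ ∧ ∃ x, Metric.closedBall x (δ / 2) ⊆ hull s}

/-- Shape regularity with constant `κ`: `h_T ≤ κ ρ_T` for all elements `T`. -/
def IsShapeRegular (κ : ℝ) : Prop := ∀ T : 𝒯.Elem, meshSize T.1 ≤ κ * inballDiam T.1

/-- The side `S` is contained in the boundary of `Ω`. -/
def IsBoundarySide (_𝒯 : Triangulation Ω) (S : Finset (E d)) : Prop := hull S ⊆ frontier Ω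

/-- The part `ΓD` of the boundary is resolved by the triangulation: it is a union of sides. -/
def Resolves (ΓD : Set (E d)) : Prop := ∀ x ∈ ΓD, ∃ S ∈ 𝒯.sides, x ∈ hull S ∧ hull S ⊆ ΓD

/-- The patch `ω_T`: the union of all elements which intersect `T`. -/
def patch (T : 𝒯.Elem) : Set (E d) :=
  ⋃ T' ∈ {T' : 𝒯.Elem | (hull T'.1 ∩ hull T.1).Nonempty}, hull T'.1

open Classical in
/-- `𝒮_h(T)`: the sides which intersect the interior of the patch `ω_T`, together with the sides
on the Dirichlet boundary which intersect `T`. -/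
def patchSides (ΓD : Set (E d)) (T : 𝒯.Elem) : Finset (Finset (E d)) :=
  𝒯.sides.filter fun S =>
    (hull S ∩ interior (𝒯.patch T)).Nonempty ∨ (hull S ⊆ ΓD ∧ (hull S ∩ hull T.1).Nonempty)

/-- The space `ℒ¹(𝒯_h)` of element-wise affine functions: one affine function for each element.
(An affine function on an element, which has interior points, has just one affine extension to
`ℝᵈ`.) -/
abbrev L1 : Type := 𝒯.Elem → (E d →ᵃ[ℝ] ℝ)

open Classical in
/-- The jump `⟦w⟧_S` of a family `w` of objects on the elements: `w T₊ - w T₋` if `S` is the common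
side of two different elements `T₊`, `T₋` (whose order is an arbitrary choice), and `w T` if `S` is
a side of `T` only. -/
def jump {M : Type*} [AddCommGroup M] (w : 𝒯.Elem → M) (S : Finset (E d)) : M :=
  if h : ∃ p : 𝒯.Elem × 𝒯.Elem, p.1 ≠ p.2 ∧ S ⊆ p.1.1 ∧ S ⊆ p.2.1 then
    w h.choose.1 - w h.choose.2
  else if h : ∃ T : 𝒯.Elem, S ⊆ T.1 then w h.choose else 0

/-- The barycenter `x_S` of the side `S`. -/
def midpoint (S : Finset (E d)) : E d := (d : ℝ)⁻¹ • ∑ z ∈ S, z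

/-- The Crouzeix-Raviart space `𝒮^{1,cr}(𝒯_h)`: the jumps across inner sides have vanishing
integral with respect to the `(d-1)`-dimensional Hausdorff measure. -/
def IsCR (v : 𝒯.L1) : Prop :=
  ∀ S ∈ 𝒯.sides, ¬ 𝒯.IsBoundarySide S → ∫ x in hull S, 𝒯.jump v S x ∂μHE[d - 1] = 0

/-- The Crouzeix-Raviart space `𝒮^{1,cr}_D(𝒯_h)`: in addition, the function vanishes at the
barycenters of the sides on the Dirichlet boundary. -/
def IsCRD (ΓD : Set (E d)) (v : 𝒯.L1) : Prop :=
  𝒯.IsCR v ∧ ∀ S ∈ 𝒯.sides, hull S ⊆ ΓD → ∀ T : 𝒯.Elem, S ⊆ T.1 → v T (midpoint S) = 0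

variable {𝒯} in
/-- The vertices of an element form an affine basis of `ℝᵈ`. -/
def Elem.basis (T : 𝒯.Elem) : AffineBasis T.1 ℝ (E d) where
  toFun := (↑)
  ind' := 𝒯.indep T.2.1
  tot' := (𝒯.indep T.2.1).affineSpan_eq_top_iff_card_eq_finrank_add_one.2 (by simp [T.2.2])

open Classical in
/-- The nodal basis function `φ_z`: on an element `T` it is the barycentric coordinate of `z` if
`z` is a vertex of `T`, and zero otherwise. -/
def nodal (z : E d) : 𝒯.L1 := fun T => if h : z ∈ T.1 then T.basis.coord ⟨z, h⟩ else 0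

open Classical in
/-- The nodal average `⟨v⟩_z`: zero if `z` is on the Dirichlet boundary, and otherwise the average
of the values at `z` over the set `𝒯_h(z)` of all elements which contain `z`. -/
def nodeAvg (ΓD : Set (E d)) (v : 𝒯.L1) (z : E d) : ℝ :=
  if z ∈ ΓD then 0
  else
    let 𝒯z := Finset.univ.filter fun T : 𝒯.Elem => z ∈ hull T.1
    (𝒯z.card : ℝ)⁻¹ * ∑ T ∈ 𝒯z, v T z

/-- The node-averaging operator `𝒥_h^{av} v = ∑_z ⟨v⟩_z φ_z`. -/
def avgOp (ΓD : Set (E d)) (v : 𝒯.L1) : 𝒯.L1 := ∑ z ∈ 𝒯.nodes, 𝒯.nodeAvg ΓD v z • 𝒯.nodal z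

/-- The gradient of an affine function on `ℝᵈ`. -/
def affGrad (f : E d →ᵃ[ℝ] ℝ) : E d :=
  (InnerProductSpace.toDual ℝ (E d)).symm (LinearMap.toContinuousLinearMap f.linear)

/-- The element-wise gradient, as one vector for each element. -/
def elemGrad (v : 𝒯.L1) : 𝒯.Elem → E d := fun T => affGrad (v T)

/-- The element-wise gradient `∇_h v` as a function on `ℝᵈ` (set to zero on the null set formed by
the boundaries of the elements, and outside of `Ω`). -/
def brokenGrad (v : 𝒯.L1) : E d → E d := fun x =>
  ∑ T : 𝒯.Elem, (interior (hull T.1)).indicator (fun _ => 𝒯.elemGrad v T) x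

end Triangulation

end FEM

end

/-!
The first inequality rests on a bound for the nodal values of `v - 𝒥_h^{av} v` on an element `T`
(`abs_sub_nodeAvg_le`). At a vertex `z` which is not on the Dirichlet boundary, such a value is a
mean of differences `v|_T(z) - v|_{T'}(z)` over the elements `T'` at `z`. The elements at `z` are
connected through sides which contain `z` (`starGraph_reachable`), so that a difference is a sum of
jumps across such sides. The jump of a Crouzeix-Raviart function across an interior side is affine
with mean value zero, hence vanishes at the barycenter (`setIntegral_hull_affine`), and is at most
`h_S |⟦∇_h v⟧_S|` on the side (`IsCR.abs_sub_le`). At a Dirichlet node, the chain is continued to a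
Dirichlet side, at the barycenter of which `v` vanishes.

The connectedness through sides is where the Lipschitz property enters: near `z`, the domain is
stable under translation by the vectors of an open cone, so that the union of the elements at `z` is
star-shaped with respect to all points of this cone near `z`. For a generic such point, the segment
to a generic point of an element avoids all faces of codimension at least two, and hence changes
the element only across sides.

The number of elements at a vertex is bounded since, shrunk to a common diameter, they contain
disjoint balls of comparable size (`card_star_le`). For `d ≥ 2`, elements with a common side have a
common edge, and are therefore comparable in size, which extends along chains to all elements of a
patch (`meshSize_le_of_common_vertex`) and gives the second inequality (`shifted_le_patchMean`).
For `d = 1` sides are points, `h_S = 0`, and the second inequality is trivial.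

The dependence on `φ` is only through monotonicity of the shifted functions and their `Δ₂`-constant.
These constants are bounded uniformly in the shift (`exists_delta2_shifted`), so that `c_φ` is a
genuine supremum, and constant factors can be moved out of the shifted functions
(`shifted_two_pow_mul_le`).
-/

noncomputable section

/-! ### Shifted N-functions -/

namespace NFun

theorem rderiv_monotoneOn {φ : ℝ → ℝ} (h : IsNFunction φ) :
    MonotoneOn (rderiv φ) (Ioi 0) := by
  have := h.convexOn.monotoneOn_rightDeriv
  rwa [interior_Ici] at this

/-- Convexity between `t` and `2 t`. -/
theorem rderiv_mul_le {φ : ℝ → ℝ} (h : IsNFunction φ) {t : ℝ} (ht : 0 < t) :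
    rderiv φ t * t ≤ φ (2 * t) - φ t := by
  have := h.convexOn.rightDeriv_le_slope_of_mem_interior (x := t) (y := 2 * t)
    (by rw [interior_Ici]; exact ht) (by simp; linarith) (by linarith)
  rw [slope_def_field, le_div_iff₀ (by linarith)] at this
  unfold rderiv
  linarith

/-- Convexity between `0` and `t`. -/
theorem le_rderiv_mul {φ : ℝ → ℝ} (h : IsNFunction φ) {t : ℝ} (ht : 0 < t) :
    φ t ≤ rderiv φ t * t := by
  have h1 := h.convexOn.leftDeriv_le_rightDeriv_of_mem_interior (x := t)
    (by rw [interior_Ici]; exact ht)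
  have h2 := h.convexOn.slope_le_leftDeriv_of_mem_interior (x := 0) (y := t)
    (by simp) (by rw [interior_Ici]; exact ht) ht
  have h3 := h2.trans h1
  rw [slope_def_field, h.zero, div_le_iff₀ (by linarith)] at h3
  unfold rderiv
  linarith

theorem IsNFunction.nonneg {φ : ℝ → ℝ} (h : IsNFunction φ) {t : ℝ} (ht : 0 ≤ t) : 0 ≤ φ t := by
  rcases ht.eq_or_lt with rfl | ht
  · exact h.zero.ge
  · exact (h.pos t ht).le

theorem rderiv_pos {φ : ℝ → ℝ} (h : IsNFunction φ) {t : ℝ} (ht : 0 < t) : 0 < rderiv φ t := by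
  have h1 := le_rderiv_mul h ht
  have h2 := h.pos t ht
  by_contra! h3
  nlinarith

/-- The `Δ₂`-condition passes to the right derivative. -/
theorem exists_rderiv_two_mul_le {φ : ℝ → ℝ} (h : IsNFunction φ) (h2 : IsDelta2 φ) :
    ∃ C, 0 < C ∧ ∀ t, 0 < t → rderiv φ (2 * t) ≤ C * rderiv φ t := by
  obtain ⟨c, hc, hφ⟩ := h2
  refine ⟨c ^ 2, by positivity, fun t ht => ?_⟩
  have e1 := rderiv_mul_le h (t := 2 * t) (by linarith)
  have e2 := hφ (2 * t) (by linarith)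
  have e3 := hφ t ht.le
  have e4 := le_rderiv_mul h ht
  have e5 := h.nonneg (t := 2 * t) (by linarith)
  have e6 : rderiv φ (2 * t) * (2 * t) ≤ c ^ 2 * rderiv φ t * t := by
    calc _ ≤ c * φ (2 * t) := by linarith
      _ ≤ c * (c * φ t) := by gcongr
      _ ≤ c * (c * (rderiv φ t * t)) := by gcongr
      _ = _ := by ring
  have e7 := rderiv_pos h (t := 2 * t) (by linarith)
  have : rderiv φ (2 * t) * t ≤ c ^ 2 * rderiv φ t * t := by nlinarith
  exact le_of_mul_le_mul_right this ht

/-- Both factors of the integrand are monotone. This includes the argument `0` for `a = 0`, where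
the integrand has the value `φ'(0) * (0 / 0) = 0`. -/
theorem shifted_integrand_monotoneOn {φ : ℝ → ℝ} (h : IsNFunction φ) {a : ℝ} (ha : 0 ≤ a) :
    MonotoneOn (fun s => rderiv φ (a + s) * (s / (a + s))) (Ici 0) := by
  intro s hs t ht hst
  rcases (mem_Ici.1 hs).eq_or_lt with rfl | hs0
  · rcases hst.eq_or_lt with rfl | ht0
    · exact le_rfl
    · have := rderiv_pos h (t := a + t) (by linarith)
      simp only [zero_div, mul_zero]
      positivity
  · have h1 := rderiv_monotoneOn h (a := a + s) (b := a + t) (by simp; linarith)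
      (by simp; linarith) (by linarith)
    have h2 : s / (a + s) ≤ t / (a + t) := by
      rw [div_le_div_iff₀ (by linarith) (by linarith)]
      nlinarith
    have h3 := rderiv_pos h (t := a + t) (by linarith)
    exact mul_le_mul h1 h2 (by positivity) h3.le

theorem shifted_integrand_nonneg {φ : ℝ → ℝ} (h : IsNFunction φ) {a : ℝ} (ha : 0 ≤ a)
    {s : ℝ} (hs : 0 ≤ s) : 0 ≤ rderiv φ (a + s) * (s / (a + s)) := by
  simpa using shifted_integrand_monotoneOn h ha (mem_Ici.2 le_rfl) (mem_Ici.2 hs) hs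

theorem shifted_integrand_integrable {φ : ℝ → ℝ} (h : IsNFunction φ) {a : ℝ} (ha : 0 ≤ a)
    {s t : ℝ} (hs : 0 ≤ s) (ht : 0 ≤ t) :
    IntervalIntegrable (fun s => rderiv φ (a + s) * (s / (a + s))) volume s t := by
  refine MonotoneOn.intervalIntegrable ((shifted_integrand_monotoneOn h ha).mono ?_)
  intro x hx
  rw [uIcc, mem_Icc] at hx
  exact (le_inf hs ht).trans hx.1

theorem shifted_zero (φ : ℝ → ℝ) (a : ℝ) : shifted φ a 0 = 0 := by simp [shifted]

theorem shifted_monotoneOn {φ : ℝ → ℝ} (h : IsNFunction φ) {a : ℝ} (ha : 0 ≤ a) :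
    MonotoneOn (shifted φ a) (Ici 0) := by
  intro s hs t ht hst
  have := intervalIntegral.integral_add_adjacent_intervals
    (shifted_integrand_integrable h ha le_rfl hs) (shifted_integrand_integrable h ha hs ht)
  unfold shifted
  rw [← this]
  have : 0 ≤ ∫ x in s..t, rderiv φ (a + x) * (x / (a + x)) :=
    intervalIntegral.integral_nonneg hst fun u hu =>
      shifted_integrand_nonneg h ha ((mem_Ici.1 hs).trans hu.1)
  linarith

theorem shifted_nonneg {φ : ℝ → ℝ} (h : IsNFunction φ) {a : ℝ} (ha : 0 ≤ a) {t : ℝ} (ht : 0 ≤ t) :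
    0 ≤ shifted φ a t := by
  simpa [shifted_zero] using shifted_monotoneOn h ha (mem_Ici.2 le_rfl) (mem_Ici.2 ht) ht

/-- The shifted functions satisfy the `Δ₂`-condition uniformly in the shift. -/
theorem exists_delta2_shifted {φ : ℝ → ℝ} (h : IsNFunction φ) (h2 : IsDelta2 φ) :
    ∃ C, ∀ a, 0 ≤ a → C ∈ delta2Set (shifted φ a) := by
  obtain ⟨C, hC, hφ⟩ := exists_rderiv_two_mul_le h h2
  refine ⟨4 * C, fun a ha => ⟨by positivity, fun t ht => ?_⟩⟩
  have e := intervalIntegral.integral_comp_mul_left (a := 0) (b := t)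
    (fun s => rderiv φ (a + s) * (s / (a + s))) (two_ne_zero (α := ℝ))
  have e' : shifted φ a (2 * t) =
      2 * ∫ s in (0 : ℝ)..t, rderiv φ (a + 2 * s) * (2 * s / (a + 2 * s)) := by
    rw [e]
    simp [shifted]
  have i1 : IntervalIntegrable (fun s => rderiv φ (a + 2 * s) * (2 * s / (a + 2 * s)))
      volume 0 t := by
    refine MonotoneOn.intervalIntegrable fun x hx y hy hxy => ?_
    rw [uIcc_of_le ht] at hx hy
    have hx' : (2 * x) ∈ Ici (0 : ℝ) := by simpa using hx.1
    have hy' : (2 * y) ∈ Ici (0 : ℝ) := by simpa using hy.1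
    exact shifted_integrand_monotoneOn h ha hx' hy' (by linarith)
  have i2 := shifted_integrand_integrable h ha le_rfl ht
  -- Monotonicity of `φ'` gives `φ'(a + 2 s) ≤ φ'(2 (a + s)) ≤ C φ'(a + s)`.
  rw [e', shifted, mul_assoc, ← intervalIntegral.integral_const_mul]
  have : ∫ s in (0 : ℝ)..t, rderiv φ (a + 2 * s) * (2 * s / (a + 2 * s)) ≤
      ∫ s in (0 : ℝ)..t, (2 * C) * (rderiv φ (a + s) * (s / (a + s))) := by
    refine intervalIntegral.integral_mono_on ht i1 (i2.const_mul _) fun s hs => ?_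
    rcases hs.1.eq_or_lt with rfl | hs0
    · simp
    · have f1 : rderiv φ (a + 2 * s) ≤ rderiv φ (2 * (a + s)) :=
        rderiv_monotoneOn h (by simp; linarith) (by simp; linarith) (by linarith)
      have f2 := f1.trans (hφ (a + s) (by linarith))
      have f3 : 2 * s / (a + 2 * s) ≤ 2 * (s / (a + s)) := by
        rw [mul_div_assoc]
        gcongr
        linarith
      have f4 := rderiv_pos h (t := a + s) (by linarith)
      calc _ ≤ (C * rderiv φ (a + s)) * (2 * (s / (a + s))) :=
            mul_le_mul f2 f3 (by positivity) (by positivity)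
        _ = _ := by ring
  rw [intervalIntegral.integral_const_mul] at this
  rw [intervalIntegral.integral_const_mul]
  linarith

/-- Because the `Δ₂`-constants of the shifted functions are bounded, the supremum `c_φ` is a
genuine one, and it is an admissible constant for every shift. -/
theorem shifted_two_mul_le {φ : ℝ → ℝ} (h : IsNFunction φ) (h2 : IsDelta2 φ) {K : ℝ}
    (hK : shiftConst φ ≤ K) {a : ℝ} (ha : 0 ≤ a) {t : ℝ} (ht : 0 ≤ t) :
    shifted φ a (2 * t) ≤ K * shifted φ a t := by
  obtain ⟨C, hC⟩ := exists_delta2_shifted h h2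
  have hb : ∀ a, BddBelow (delta2Set (shifted φ a)) := fun a => ⟨0, fun c hc => hc.1.le⟩
  have h1 : delta2 (shifted φ a) ≤ K := by
    have hbdd : BddAbove ((fun a => delta2 (shifted φ a)) '' Ici 0) := by
      refine ⟨C, ?_⟩
      rintro _ ⟨b, hb', rfl⟩
      exact csInf_le (hb b) (hC b hb')
    exact (le_csSup hbdd ⟨a, ha, rfl⟩).trans hK
  have h0 := shifted_nonneg h ha ht
  refine le_trans ?_ (mul_le_mul_of_nonneg_right h1 h0)
  -- The infimum `Δ₂(φ_a)` is attained.
  rcases h0.eq_or_lt with h0 | h0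
  · simpa [← h0] using (hC a ha).2 t ht
  · rw [← div_le_iff₀ h0]
    refine le_csInf ⟨C, hC a ha⟩ fun c hc => ?_
    rw [div_le_iff₀ h0]
    exact hc.2 t ht

theorem shifted_two_pow_mul_le {φ : ℝ → ℝ} (h : IsNFunction φ) (h2 : IsDelta2 φ) {K : ℝ}
    (hK : shiftConst φ ≤ K) (hK0 : 0 ≤ K) {a : ℝ} (ha : 0 ≤ a) {t : ℝ} (ht : 0 ≤ t) (k : ℕ) :
    shifted φ a (2 ^ k * t) ≤ K ^ k * shifted φ a t := by
  induction k with
  | zero => simp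
  | succ k ih =>
    rw [pow_succ', pow_succ', mul_assoc, mul_assoc]
    exact (shifted_two_mul_le h h2 hK ha (by positivity)).trans (by gcongr)

/-- No convexity is needed: the sum is at most the number of its terms times the largest one. -/
theorem shifted_mul_sum_le {φ : ℝ → ℝ} (h : IsNFunction φ) (h2 : IsDelta2 φ) {K : ℝ}
    (hK : shiftConst φ ≤ K) (hK0 : 0 ≤ K) {a : ℝ} (ha : 0 ≤ a) {ι : Type*} (I : Finset ι)
    {t : ι → ℝ} (ht : ∀ i ∈ I, 0 ≤ t i) {A : ℝ} (hA : 0 ≤ A) {k : ℕ} (hk : A * I.card ≤ 2 ^ k) :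
    shifted φ a (A * ∑ i ∈ I, t i) ≤ K ^ k * ∑ i ∈ I, shifted φ a (t i) := by
  rcases I.eq_empty_or_nonempty with rfl | hne
  · simp [shifted_zero]
  obtain ⟨j, hj, hmax⟩ := I.exists_max_image t hne
  have h1 : A * ∑ i ∈ I, t i ≤ 2 ^ k * t j := by
    have := Finset.sum_le_card_nsmul I t (t j) hmax
    rw [nsmul_eq_mul] at this
    calc A * ∑ i ∈ I, t i ≤ A * (I.card * t j) := by gcongr
      _ = A * I.card * t j := by ring
      _ ≤ 2 ^ k * t j := mul_le_mul_of_nonneg_right hk (ht j hj)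
  have h0 : 0 ≤ A * ∑ i ∈ I, t i := mul_nonneg hA (Finset.sum_nonneg ht)
  calc shifted φ a (A * ∑ i ∈ I, t i) ≤ shifted φ a (2 ^ k * t j) :=
        shifted_monotoneOn h ha h0 (h0.trans h1) h1
    _ ≤ K ^ k * shifted φ a (t j) := shifted_two_pow_mul_le h h2 hK hK0 ha (ht j hj) k
    _ ≤ _ := by
      gcongr
      exact Finset.single_le_sum (f := fun i => shifted φ a (t i))
        (fun i hi => shifted_nonneg h ha (ht i hi)) hj

theorem measurable_shifted_comp {φ : ℝ → ℝ} (h : IsNFunction φ) {a : ℝ} (ha : 0 ≤ a)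
    {α : Type*} [MeasurableSpace α] {g : α → ℝ} (hg : Measurable g) (hg0 : ∀ x, 0 ≤ g x) :
    Measurable fun x => shifted φ a (g x) := by
  have hm : Monotone fun t => shifted φ a (max t 0) := fun s t hst =>
    shifted_monotoneOn h ha (le_max_right s 0) (le_max_right t 0) (max_le_max_right 0 hst)
  have := hm.measurable.comp hg
  convert this using 1
  funext x
  simp [hg0 x]

end NFun

namespace FEM.Triangulation

variable {d : ℕ} {Ω : Set (E d)} {𝒯 : Triangulation Ω}

/-! ### Barycentric coordinates on the elements -/

theorem nodal_of_mem {T : 𝒯.Elem} {z : E d} (hz : z ∈ T.1) :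
    𝒯.nodal z T = T.basis.coord ⟨z, hz⟩ := by simp [nodal, hz]

theorem nodal_of_notMem {T : 𝒯.Elem} {z : E d} (hz : z ∉ T.1) : 𝒯.nodal z T = 0 := by
  simp [nodal, hz]

open Classical in
theorem nodal_apply_vertex {T : 𝒯.Elem} (z : E d) {y : E d} (hy : y ∈ T.1) :
    𝒯.nodal z T y = if y = z then 1 else 0 := by
  by_cases hz : z ∈ T.1
  · rw [nodal_of_mem hz]
    have : (y : E d) = T.basis ⟨y, hy⟩ := rfl
    conv_lhs => rw [this]
    rw [AffineBasis.coord_apply]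
    simp [eq_comm]
  · rw [nodal_of_notMem hz, if_neg (by rintro rfl; exact hz hy)]
    rfl

theorem range_basis (T : 𝒯.Elem) : range T.basis = (T.1 : Set (E d)) := by
  ext x
  exact ⟨by rintro ⟨⟨y, hy⟩, rfl⟩; exact hy, fun hx => ⟨⟨x, hx⟩, rfl⟩⟩

theorem mem_hull_iff {T : 𝒯.Elem} {x : E d} :
    x ∈ hull T.1 ↔ ∀ z ∈ T.1, 0 ≤ 𝒯.nodal z T x := by
  have := T.basis.convexHull_eq_nonneg_coord
  rw [range_basis] at this
  rw [hull, this]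
  constructor
  · intro h z hz
    rw [nodal_of_mem hz]; exact h _
  · rintro h ⟨z, hz⟩
    rw [← nodal_of_mem hz]; exact h z hz

theorem mem_interior_hull_iff {T : 𝒯.Elem} {x : E d} :
    x ∈ interior (hull T.1) ↔ ∀ z ∈ T.1, 0 < 𝒯.nodal z T x := by
  have := T.basis.interior_convexHull
  rw [range_basis] at this
  rw [hull, this]
  constructor
  · intro h z hz
    rw [nodal_of_mem hz]; exact h _
  · rintro h ⟨z, hz⟩
    rw [← nodal_of_mem hz]; exact h z hz

theorem eq_of_eqOn_vertices {T : 𝒯.Elem} {f g : E d →ᵃ[ℝ] ℝ} (h : ∀ z ∈ T.1, f z = g z) :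
    f = g :=
  AffineMap.ext_on T.basis.tot (by
    rintro _ ⟨⟨z, hz⟩, rfl⟩
    exact h z hz)

theorem continuous_affine (f : E d →ᵃ[ℝ] ℝ) : Continuous f :=
  f.continuous_of_finiteDimensional

theorem interior_hull_nonempty (T : 𝒯.Elem) : (interior (hull T.1)).Nonempty := by
  have := T.basis.centroid_mem_interior_convexHull
  rw [range_basis] at this
  exact ⟨_, this⟩

theorem nonempty (T : 𝒯.Elem) : T.1.Nonempty := by
  rw [← Finset.card_pos, T.2.2]; omega

theorem isCompact_hull (s : Finset (E d)) : IsCompact (hull s) :=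
  s.finite_toSet.isCompact_convexHull ℝ

theorem isClosed_hull (s : Finset (E d)) : IsClosed (hull s) := (isCompact_hull s).isClosed

theorem convex_hull (s : Finset (E d)) : Convex ℝ (hull s) := convex_convexHull ℝ _

theorem subset_hull (s : Finset (E d)) : (s : Set (E d)) ⊆ hull s := subset_convexHull ℝ _

theorem hull_mono {s t : Finset (E d)} (h : s ⊆ t) : hull s ⊆ hull t :=
  convexHull_mono (by exact_mod_cast h)

theorem closure_interior_hull (T : 𝒯.Elem) : closure (interior (hull T.1)) = hull T.1 := by
  have := Convex.closure_interior_eq_closure_of_nonempty_interior (𝕜 := ℝ) (convex_hull T.1)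
    (interior_hull_nonempty T)
  rwa [(isClosed_hull _).closure_eq] at this

/-- On a closed simplex an affine function is bounded by its values at the vertices. -/
theorem abs_le_of_vertices {s : Finset (E d)} (f : E d →ᵃ[ℝ] ℝ) {M : ℝ}
    (h : ∀ z ∈ s, |f z| ≤ M) {x : E d} (hx : x ∈ hull s) : |f x| ≤ M := by
  have hc : Convex ℝ (f ⁻¹' Icc (-M) M) := (convex_Icc _ _).affine_preimage f
  exact abs_le.2 (convexHull_min (fun z hz => abs_le.1 (h z hz)) hc hx)

theorem eq_zero_of_vertices {s : Finset (E d)} (f : E d →ᵃ[ℝ] ℝ)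
    (h : ∀ z ∈ s, f z = 0) {x : E d} (hx : x ∈ hull s) : f x = 0 :=
  abs_nonpos_iff.1 (abs_le_of_vertices f (fun z hz => by simp [h z hz]) hx)

theorem nodal_eq_zero_of_mem_hull {T : 𝒯.Elem} {s : Finset (E d)} (hs : s ⊆ T.1) {z x : E d}
    (hz : z ∉ s) (hx : x ∈ hull s) : 𝒯.nodal z T x = 0 := by
  classical
  refine eq_zero_of_vertices _ (fun y hy => ?_) hx
  rw [nodal_apply_vertex z (hs hy), if_neg (by rintro rfl; exact hz hy)]

/-! ### The elements of a conforming triangulation -/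

open Classical in
theorem inter_hull_subset {s t : Finset (E d)} (hs : s ∈ 𝒯.faces) (ht : t ∈ 𝒯.faces) :
    hull s ∩ hull t ⊆ hull (s ∩ t) := by
  have := 𝒯.inter_subset_convexHull hs ht
  rwa [← Finset.coe_inter] at this

/-- An interior point of an element belongs to no faces other than those which contain all vertices
of the element. -/
theorem subset_of_mem_interior_hull {T : 𝒯.Elem} {s : Finset (E d)} (hs : s ∈ 𝒯.faces)
    {x : E d} (hx : x ∈ interior (hull T.1)) (hxs : x ∈ hull s) : T.1 ⊆ s := by
  classical
  intro z hz
  by_contra hzs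
  have h1 := inter_hull_subset T.2.1 hs ⟨interior_subset hx, hxs⟩
  have h2 := mem_interior_hull_iff.1 hx z hz
  rw [nodal_eq_zero_of_mem_hull Finset.inter_subset_left (by simp [hzs]) h1] at h2
  exact lt_irrefl _ h2

theorem eq_of_subset {T T' : 𝒯.Elem} (h : T.1 ⊆ T'.1) : T = T' :=
  Subtype.ext (Finset.eq_of_subset_of_card_le h (by rw [T.2.2, T'.2.2]))

theorem eq_of_mem_interior_hull {T T' : 𝒯.Elem} {x : E d} (hx : x ∈ interior (hull T.1))
    (hx' : x ∈ hull T'.1) : T = T' :=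
  eq_of_subset (subset_of_mem_interior_hull T'.2.1 hx hx')

theorem mem_of_mem_hull {s : Finset (E d)} (hs : s ∈ 𝒯.faces) {T : 𝒯.Elem} {z : E d}
    (hz : z ∈ T.1) (hzs : z ∈ hull s) : z ∈ s := by
  classical
  have h1 : {z} ∈ 𝒯.faces :=
    𝒯.down_closed T.2.1 (Finset.singleton_subset_iff.2 hz) (Finset.singleton_nonempty z)
  have h2 := inter_hull_subset h1 hs ⟨by simp [hull], hzs⟩
  by_contra h
  rw [Finset.singleton_inter_of_notMem h] at h2
  simp [hull] at h2

theorem exists_common_vertex {s t : Finset (E d)} (hs : s ∈ 𝒯.faces) (ht : t ∈ 𝒯.faces)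
    (h : (hull s ∩ hull t).Nonempty) : ∃ z, z ∈ s ∧ z ∈ t := by
  classical
  obtain ⟨x, hx⟩ := h
  have h2 := inter_hull_subset hs ht hx
  by_contra! h
  have : s ∩ t = ∅ := Finset.disjoint_iff_inter_eq_empty.1 (Finset.disjoint_left.2 h)
  rw [this] at h2
  simp [hull] at h2

theorem mem_sides {S : Finset (E d)} : S ∈ 𝒯.sides ↔ ∃ T : 𝒯.Elem, S ⊆ T.1 ∧ S.card = d := by
  simp [sides, Finset.mem_powersetCard]

theorem mem_nodes {z : E d} : z ∈ 𝒯.nodes ↔ ∃ T : 𝒯.Elem, z ∈ T.1 := by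
  simp [nodes]

/-! ### Elements with a common side -/

theorem apply_midpoint {S : Finset (E d)} (hd : 1 ≤ d) (hS : S.card = d) (f : E d →ᵃ[ℝ] ℝ) :
    f (midpoint S) = (d : ℝ)⁻¹ * ∑ z ∈ S, f z := by
  have h : ∀ x, f x = f.linear x + f 0 := fun x => congrFun f.decomp x
  have hd' : (d : ℝ) ≠ 0 := by positivity
  rw [h (midpoint S), midpoint, map_smul, map_sum, Finset.sum_congr rfl fun z _ => h z,
    Finset.sum_add_distrib, Finset.sum_const, hS]
  simp
  field_simp

theorem nodal_midpoint {T : 𝒯.Elem} {S : Finset (E d)} (hd : 1 ≤ d) (hS : S.card = d)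
    (hT : S ⊆ T.1) {z : E d} (hz : z ∈ S) : 𝒯.nodal z T (midpoint S) = (d : ℝ)⁻¹ := by
  classical
  rw [apply_midpoint hd hS, Finset.sum_congr rfl fun y hy => nodal_apply_vertex z (hT hy)]
  simp [hz]

theorem midpoint_mem_hull {S : Finset (E d)} (hd : 1 ≤ d) (hS : S.card = d) :
    midpoint S ∈ hull S := by
  have hd' : (d : ℝ) ≠ 0 := by positivity
  rw [midpoint, Finset.smul_sum]
  refine (convex_hull S).sum_mem (fun _ _ => by positivity) ?_ fun z hz => subset_hull S hz
  rw [Finset.sum_const, hS]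
  simp [hd']

theorem exists_opposite {T : 𝒯.Elem} {S : Finset (E d)} (hS : S.card = d) (hT : S ⊆ T.1) :
    ∃ a, a ∈ T.1 ∧ a ∉ S ∧ ∀ z ∈ T.1, z = a ∨ z ∈ S := by
  classical
  have h : (T.1 \ S).card = 1 := by
    rw [Finset.card_sdiff_of_subset hT, T.2.2, hS]; omega
  obtain ⟨a, ha⟩ := Finset.card_eq_one.1 h
  have h1 : a ∈ T.1 \ S := by simp [ha]
  rw [Finset.mem_sdiff] at h1
  refine ⟨a, h1.1, h1.2, fun z hz => ?_⟩
  by_cases hzS : z ∈ S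
  · exact .inr hzS
  · left
    have : z ∈ T.1 \ S := by simp [hz, hzS]
    simpa [ha] using this

/-- Elements with a common side lie on opposite sides of it: otherwise, they would overlap near the
barycenter of the side. -/
theorem nodal_opposite_neg (hd : 1 ≤ d) {T₁ T₂ : 𝒯.Elem} (hne : T₁ ≠ T₂) {S : Finset (E d)}
    (hS : S.card = d) (h₁ : S ⊆ T₁.1) (h₂ : S ⊆ T₂.1) {a b : E d} (ha : a ∈ T₁.1) (haS : a ∉ S)
    (hbS : b ∉ S) (hb' : ∀ z ∈ T₂.1, z = b ∨ z ∈ S) :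
    𝒯.nodal b T₂ a < 0 := by
  classical
  by_contra! hneg
  -- A point slightly off the barycenter in the direction of `a` would belong to both elements, hence
  -- to their common face, where the coordinate of `a` vanishes.
  have haT₂ : a ∉ T₂.1 := by
    intro h
    refine hne (Subtype.ext ?_)
    have e : ∀ T : 𝒯.Elem, S ⊆ T.1 → a ∈ T.1 → insert a S = T.1 := fun T hT haT =>
      Finset.eq_of_subset_of_card_le (Finset.insert_subset haT hT)
        (by rw [T.2.2, Finset.card_insert_of_notMem haS, hS])
    rw [← e T₁ h₁ ha, e T₂ h₂ h]
  have hd' : (0 : ℝ) < (d : ℝ)⁻¹ := by positivity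
  have hev : ∀ᶠ ε in 𝓝[>] (0 : ℝ), ∀ z ∈ S,
      0 < 𝒯.nodal z T₂ (AffineMap.lineMap (midpoint S) a ε) := by
    rw [Finset.eventually_all]
    intro z hz
    have hc : Continuous fun ε : ℝ => 𝒯.nodal z T₂ (AffineMap.lineMap (midpoint S) a ε) :=
      (continuous_affine _).comp AffineMap.lineMap_continuous
    have := (hc.tendsto 0).eventually (lt_mem_nhds (a := 0)
      (by simpa [nodal_midpoint hd hS h₂ hz] using hd'))
    exact this.filter_mono nhdsWithin_le_nhds
  have h1 : ∀ᶠ ε in 𝓝[>] (0 : ℝ), ε ∈ Ioc (0 : ℝ) 1 := Ioc_mem_nhdsGT one_pos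
  obtain ⟨ε, hε, hε0, hε1⟩ := (hev.and h1).exists
  set y := AffineMap.lineMap (midpoint S) a ε with hy
  have hy1 : y ∈ hull T₁.1 :=
    (convex_hull T₁.1).lineMap_mem (hull_mono h₁ (midpoint_mem_hull hd hS)) (subset_hull _ ha)
      ⟨hε0.le, hε1⟩
  have hmb : 𝒯.nodal b T₂ (midpoint S) = 0 :=
    nodal_eq_zero_of_mem_hull h₂ hbS (midpoint_mem_hull hd hS)
  have hma : 𝒯.nodal a T₁ (midpoint S) = 0 :=
    nodal_eq_zero_of_mem_hull h₁ haS (midpoint_mem_hull hd hS)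
  have hy2 : y ∈ hull T₂.1 := by
    refine mem_hull_iff.2 fun z hz => ?_
    rcases hb' z hz with rfl | hzS
    · rw [hy, AffineMap.apply_lineMap, hmb, AffineMap.lineMap_apply]
      simp only [vsub_eq_sub, sub_zero, smul_eq_mul, vadd_eq_add, add_zero]
      positivity
    · exact (hε z hzS).le
  have h3 := nodal_eq_zero_of_mem_hull (T := T₁) (z := a) Finset.inter_subset_left
    (by simp [haT₂]) (inter_hull_subset T₁.2.1 T₂.2.1 ⟨hy1, hy2⟩)
  rw [hy, AffineMap.apply_lineMap, hma, AffineMap.lineMap_apply, nodal_apply_vertex a ha] at h3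
  simp at h3
  exact hε0.ne' h3

/-- The barycentric coordinates of the vertices opposite to a common side are proportional, since
both vanish on the side. -/
theorem nodal_eq_mul {T₁ T₂ : 𝒯.Elem} {S : Finset (E d)}
    (h₂ : S ⊆ T₂.1) {a b : E d} (haS : a ∉ S)
    (h₁ : S ⊆ T₁.1) (ha : a ∈ T₁.1) (ha' : ∀ z ∈ T₁.1, z = a ∨ z ∈ S) (hbS : b ∉ S) (x : E d) :
    𝒯.nodal b T₂ x = 𝒯.nodal b T₂ a * 𝒯.nodal a T₁ x := by
  classical
  have : 𝒯.nodal b T₂ = 𝒯.nodal b T₂ a • 𝒯.nodal a T₁ := by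
    refine eq_of_eqOn_vertices (T := T₁) fun z hz => ?_
    rcases ha' z hz with rfl | hzS
    · simp [nodal_apply_vertex z hz]
    · simp [nodal_apply_vertex _ (h₂ hzS), nodal_apply_vertex _ (h₁ hzS),
        ne_of_mem_of_not_mem hzS hbS, ne_of_mem_of_not_mem hzS haS]
  rw [this]
  simp [nodal_apply_vertex a ha]

/-- Two elements with a common side cover a neighbourhood of its barycenter: there the coordinates
of the vertices of the side are positive, and one of the two remaining ones is nonnegative. -/
theorem midpoint_mem_interior (hd : 1 ≤ d) {T₁ T₂ : 𝒯.Elem} (hne : T₁ ≠ T₂) {S : Finset (E d)}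
    (hS : S.card = d) (h₁ : S ⊆ T₁.1) (h₂ : S ⊆ T₂.1) :
    midpoint S ∈ interior (hull T₁.1 ∪ hull T₂.1) := by
  obtain ⟨a, ha, haS, ha'⟩ := exists_opposite hS h₁
  obtain ⟨b, hb, hbS, hb'⟩ := exists_opposite hS h₂
  have hneg := nodal_opposite_neg hd hne hS h₁ h₂ ha haS hbS hb'
  have hd' : (0 : ℝ) < (d : ℝ)⁻¹ := by positivity
  have hev : ∀ T : 𝒯.Elem, S ⊆ T.1 → ∀ᶠ y in 𝓝 (midpoint S), ∀ z ∈ S, 0 < 𝒯.nodal z T y := by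
    intro T hT
    rw [Finset.eventually_all]
    intro z hz
    exact ((continuous_affine _).tendsto _).eventually (lt_mem_nhds
      (by simpa [nodal_midpoint hd hS hT hz] using hd'))
  rw [mem_interior_iff_mem_nhds]
  filter_upwards [hev T₁ h₁, hev T₂ h₂] with y hy1 hy2
  rcases le_or_gt 0 (𝒯.nodal a T₁ y) with h | h
  · left
    refine mem_hull_iff.2 fun z hz => ?_
    rcases ha' z hz with rfl | hzS
    exacts [h, (hy1 z hzS).le]
  · right
    refine mem_hull_iff.2 fun z hz => ?_
    rcases hb' z hz with rfl | hzS
    · rw [nodal_eq_mul h₂ haS h₁ ha ha' hbS]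
      exact (mul_pos_of_neg_of_neg hneg h).le
    · exact (hy2 z hzS).le

/-- A side belongs to at most two elements. -/
theorem eq_or_eq_of_common_side (hd : 1 ≤ d) {T₁ T₂ T₃ : 𝒯.Elem} (hne : T₁ ≠ T₂)
    {S : Finset (E d)} (hS : S.card = d) (h₁ : S ⊆ T₁.1) (h₂ : S ⊆ T₂.1) (h₃ : S ⊆ T₃.1) :
    T₃ = T₁ ∨ T₃ = T₂ := by
  by_contra! h
  obtain ⟨a, ha, haS, ha'⟩ := exists_opposite hS h₁
  obtain ⟨b, hb, hbS, hb'⟩ := exists_opposite hS h₂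
  obtain ⟨c, hc, hcS, hc'⟩ := exists_opposite hS h₃
  have h12 := nodal_opposite_neg hd hne hS h₁ h₂ ha haS hbS hb'
  have h13 := nodal_opposite_neg hd h.1.symm hS h₁ h₃ ha haS hcS hc'
  have h23 := nodal_opposite_neg hd h.2.symm hS h₂ h₃ hb hbS hcS hc'
  rw [nodal_eq_mul h₃ hbS h₂ hb hb' hcS] at h13
  exact absurd h13 (mul_pos_of_neg_of_neg h23 h12).not_gt

theorem hull_subset_closure (T : 𝒯.Elem) : hull T.1 ⊆ closure Ω := by
  rw [← 𝒯.space_eq]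
  exact 𝒯.toSimplicialComplex.convexHull_subset_space T.2.1

theorem exists_elem_of_face {s : Finset (E d)} (hs : s ∈ 𝒯.faces) : ∃ T : 𝒯.Elem, s ⊆ T.1 := by
  obtain ⟨t, ht, hst, hc⟩ := 𝒯.pure s hs
  exact ⟨⟨t, ht, hc⟩, hst⟩

theorem exists_mem_hull {x : E d} (hx : x ∈ closure Ω) : ∃ T : 𝒯.Elem, x ∈ hull T.1 := by
  rw [← 𝒯.space_eq, Geometry.SimplicialComplex.mem_space_iff] at hx
  obtain ⟨s, hs, hx⟩ := hx
  obtain ⟨T, hT⟩ := exists_elem_of_face hs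
  exact ⟨T, hull_mono hT hx⟩

end FEM.Triangulation

namespace FEM

/-! ### Lipschitz domains near a point of the closure -/

variable {d : ℕ} {Ω : Set (E d)}

/-- The graph function is attained at the boundary point. -/
theorem height_eq_of_mem_frontier (hΩ : IsOpen Ω) {x n : E d} {L : NNReal} {γ : E d → ℝ}
    (hγ : LipschitzWith L γ) (hx : x ∈ frontier Ω)
    (h : ∀ᶠ y in 𝓝 x, (y ∈ Ω ↔ γ (y - inner ℝ n y • n) < inner ℝ n y)) :
    γ (x - inner ℝ n x • n) = inner ℝ n x := by
  have hc : Continuous fun y : E d => γ (y - inner ℝ n y • n) :=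
    hγ.continuous.comp (by fun_prop)
  have hc' : Continuous fun y : E d => inner ℝ n y := by fun_prop
  rw [hΩ.frontier_eq] at hx
  refine le_antisymm ?_ ?_
  · by_contra! hlt
    have h1 := (hc'.tendsto x).eventually_lt (hc.tendsto x) hlt
    obtain ⟨y, hyΩ, hy1, hy2⟩ := ((mem_closure_iff_frequently.1 hx.1).and_eventually
      (h.and h1)).exists
    exact absurd (hy1.1 hyΩ) hy2.not_gt
  · by_contra! hlt
    exact hx.2 (h.self_of_nhds.2 hlt)

/-- Points slightly below a boundary point are outside of the closure. -/
theorem IsLipschitzDomain.notMem_interior_closure (hΩ : IsLipschitzDomain Ω) {x : E d}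
    (hx : x ∈ frontier Ω) : x ∉ interior (closure Ω) := by
  obtain ⟨n, L, γ, hn, hγ, h⟩ := hΩ.lipschitz x hx
  have h0 := height_eq_of_mem_frontier hΩ.isOpen hγ hx h
  have hc : Continuous fun y : E d => γ (y - inner ℝ n y • n) :=
    hγ.continuous.comp (by fun_prop)
  have hc' : Continuous fun y : E d => inner ℝ n y := by fun_prop
  intro hxi
  have hcε : Continuous fun ε : ℝ => x - ε • n := by fun_prop
  have hl : Tendsto (fun ε : ℝ => x - ε • n) (𝓝[>] 0) (𝓝 x) := by
    have := hcε.tendsto 0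
    simp only [zero_smul, sub_zero] at this
    exact this.mono_left nhdsWithin_le_nhds
  have hxi' : ∀ᶠ y in 𝓝 x, y ∈ closure Ω := mem_interior_iff_mem_nhds.1 hxi
  have hev := hl.eventually (h.eventually_nhds.and hxi')
  obtain ⟨ε, ⟨h1, h2⟩, hε⟩ := (hev.and (eventually_mem_nhdsWithin (s := Ioi (0 : ℝ)))).exists
  have hε : 0 < ε := hε
  have hnn : inner ℝ n n = 1 := by rw [real_inner_self_eq_norm_sq, hn]; norm_num
  have e1 : inner ℝ n (x - ε • n) = inner ℝ n x - ε := by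
    rw [inner_sub_right, inner_smul_right, hnn, mul_one]
  have e2 : x - ε • n - inner ℝ n (x - ε • n) • n = x - inner ℝ n x • n := by
    rw [e1, sub_smul]; abel
  have hlt : inner ℝ n (x - ε • n) < γ (x - ε • n - inner ℝ n (x - ε • n) • n) := by
    rw [e2, h0, e1]; linarith
  have h3 := (hc'.tendsto (x - ε • n)).eventually_lt (hc.tendsto _) hlt
  obtain ⟨y, hyΩ, hy1, hy2⟩ := ((mem_closure_iff_frequently.1 h2).and_eventually
      (h1.and h3)).exists
  exact absurd (hy1.1 hyΩ) hy2.not_gt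

theorem IsLipschitzDomain.interior_closure_subset (hΩ : IsLipschitzDomain Ω) :
    interior (closure Ω) ⊆ Ω := by
  intro x hx
  by_contra h
  refine hΩ.notMem_interior_closure ?_ hx
  rw [hΩ.isOpen.frontier_eq]
  exact ⟨interior_subset hx, h⟩

/-- Near each point of its closure, a Lipschitz domain is stable under translation by the vectors
of an open cone. -/
theorem IsLipschitzDomain.exists_cone (hΩ : IsLipschitzDomain Ω) {z : E d} (hz : z ∈ closure Ω) :
    ∃ r > 0, ∃ K : Set (E d), IsOpen K ∧ K.Nonempty ∧ (∀ k ∈ K, ∀ t : ℝ, 0 < t → t • k ∈ K) ∧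
      (∀ k ∈ K, ‖k‖ < r → z + k ∈ Ω) ∧
      ∀ p ∈ Ω, ‖p - z‖ < r → ∀ k ∈ K, ‖p + k - z‖ < r → p + k ∈ Ω := by
  by_cases hzΩ : z ∈ Ω
  · obtain ⟨r, hr, hb⟩ := Metric.isOpen_iff.1 hΩ.isOpen z hzΩ
    refine ⟨r, hr, univ, isOpen_univ, univ_nonempty, fun _ _ _ _ => mem_univ _,
      fun k _ hk => hb ?_, fun p _ _ k _ hk => hb ?_⟩
    · simpa [Metric.mem_ball, dist_eq_norm] using hk
    · simpa [Metric.mem_ball, dist_eq_norm] using hk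
  · have hzf : z ∈ frontier Ω := by
      rw [hΩ.isOpen.frontier_eq]; exact ⟨hz, hzΩ⟩
    obtain ⟨n, L, γ, hn, hγ, h⟩ := hΩ.lipschitz z hzf
    have h0 := height_eq_of_mem_frontier hΩ.isOpen hγ hzf h
    have hnn : inner ℝ n n = 1 := by rw [real_inner_self_eq_norm_sq, hn]; norm_num
    obtain ⟨r, hr, hb⟩ := Metric.eventually_nhds_iff.1 h
    -- The vectors which are steeper than the graph of `γ` lead from the epigraph into its interior.
    have key : ∀ p k : E d, γ (p - inner ℝ n p • n) ≤ inner ℝ n p →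
        L * ‖k - inner ℝ n k • n‖ < inner ℝ n k →
        γ (p + k - inner ℝ n (p + k) • n) < inner ℝ n (p + k) := by
      intro p k hp hk
      have h1 := hγ.dist_le_mul (p + k - inner ℝ n (p + k) • n) (p - inner ℝ n p • n)
      have e : p + k - inner ℝ n (p + k) • n - (p - inner ℝ n p • n) =
          k - inner ℝ n k • n := by
        rw [inner_add_right, add_smul]; abel
      rw [dist_eq_norm (p + k - _), e, Real.dist_eq] at h1
      have h2 := (le_abs_self _).trans h1
      rw [inner_add_right n p k] at *
      linarith
    refine ⟨r, hr, {k | L * ‖k - inner ℝ n k • n‖ < inner ℝ n k},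
      isOpen_lt (by fun_prop) (by fun_prop), ⟨n, by simp [hn]⟩, ?_, ?_, ?_⟩
    · intro k hk t ht
      have e : t • k - inner ℝ n (t • k) • n = t • (k - inner ℝ n k • n) := by
        rw [inner_smul_right, smul_sub, mul_smul]
      rw [mem_ofPred_eq] at hk ⊢
      rw [e, inner_smul_right, norm_smul, Real.norm_eq_abs, abs_of_pos ht]
      nlinarith
    · intro k hk hkr
      exact (hb (by simpa [dist_eq_norm] using hkr)).2 (key z k h0.le hk)
    · intro p hp hpr k hk hkr
      exact (hb (by simpa [dist_eq_norm] using hkr)).2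
        (key p k ((hb (by simpa [dist_eq_norm] using hpr)).1 hp).le hk)

/-! ### Avoiding finitely many proper affine subspaces -/

/-- A nonempty open set is not covered by finitely many proper affine subspaces, which are null
sets. -/
theorem exists_mem_forall_notMem {U : Set (E d)} (hU : IsOpen U) (hne : U.Nonempty)
    {ι : Type*} (I : Set ι) (hI : I.Finite) (A : ι → AffineSubspace ℝ (E d))
    (hA : ∀ i ∈ I, A i ≠ ⊤) : ∃ x ∈ U, ∀ i ∈ I, x ∉ A i := by
  by_contra! h
  have h1 : U ⊆ ⋃ i ∈ I, (A i : Set (E d)) := fun x hx => by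
    obtain ⟨i, hi, hxi⟩ := h x hx
    exact mem_biUnion hi hxi
  have h2 : volume (⋃ i ∈ I, (A i : Set (E d))) = 0 :=
    (measure_biUnion_null_iff hI.countable).2 fun i hi =>
      Measure.addHaar_affineSubspace _ _ (hA i hi)
  exact (hU.measure_pos volume hne).ne' (measure_mono_null h1 h2)

theorem affineSpan_ne_top_of_card_le {F : Finset (E d)} (hF : F.card ≤ d) :
    affineSpan ℝ (F : Set (E d)) ≠ ⊤ := by
  classical
  intro h
  rcases F.eq_empty_or_nonempty with rfl | hne
  · simp at h
  · obtain ⟨m, hm⟩ := Nat.exists_eq_succ_of_ne_zero (Finset.card_pos.2 hne).ne'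
    have h1 := finrank_vectorSpan_image_finset_le ℝ (id : E d → E d) F hm
    rw [Finset.image_id, ← direction_affineSpan, h, AffineSubspace.direction_top, finrank_top,
      finrank_euclideanSpace_fin] at h1
    omega

namespace Triangulation

variable {𝒯 : Triangulation Ω}

/-! ### The elements at a vertex are connected through sides -/

/-- The adjacency graph of the elements at the vertex `z`: two elements are adjacent if they
have a common side which contains `z`. -/
def starGraph (𝒯 : Triangulation Ω) (z : E d) : SimpleGraph {T : 𝒯.Elem // z ∈ T.1} where
  Adj T T' := T ≠ T' ∧ ∃ S : Finset (E d), S.card = d ∧ z ∈ S ∧ S ⊆ T.1.1 ∧ S ⊆ T'.1.1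
  symm := ⟨fun _ _ ⟨h, S, hS, hz, h1, h2⟩ => ⟨h.symm, S, hS, hz, h2, h1⟩⟩
  loopless := ⟨fun _ h => h.1 rfl⟩

theorem interior_hull_subset (hΩ : IsLipschitzDomain Ω) (T : 𝒯.Elem) :
    interior (hull T.1) ⊆ Ω :=
  (interior_mono (hull_subset_closure T)).trans hΩ.interior_closure_subset

theorem eventually_mem_of_mem_hull {T₀ : 𝒯.Elem} {z : E d} (hz : z ∈ T₀.1) :
    ∀ᶠ x in 𝓝 z, ∀ T : 𝒯.Elem, x ∈ hull T.1 → z ∈ T.1 := by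
  rw [eventually_all]
  intro T
  by_cases h : z ∈ T.1
  · exact Eventually.of_forall fun _ _ => h
  · have : z ∉ hull T.1 := fun h' => h (mem_of_mem_hull T.2.1 hz h')
    filter_upwards [(isClosed_hull T.1).isOpen_compl.mem_nhds this] with x hx hx'
    exact absurd hx' hx

/-- A segment which runs through elements at `z` only, and avoids all faces of codimension at least
two, changes the element only across sides. -/
theorem reachable_of_segment {z p w : E d} {T Tw : {T : 𝒯.Elem // z ∈ T.1}}
    (hp : p ∈ hull T.1.1) (hw : w ∈ hull Tw.1.1)
    (hpF : ∀ F ∈ 𝒯.faces, F.card ≤ d → p ∉ affineSpan ℝ (F : Set (E d)))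
    (hwF : ∀ F ∈ 𝒯.faces, F.card < d → w ∉ affineSpan ℝ (insert p (F : Set (E d))))
    (hseg : ∀ x ∈ segment ℝ p w, ∃ T : {T : 𝒯.Elem // z ∈ T.1}, x ∈ hull T.1.1) :
    (𝒯.starGraph z).Reachable T Tw := by
  classical
  by_contra hcon
  -- The segment is covered by the closed union `A` of the elements in the component of `T` and the
  -- closed union `B` of the others, which therefore have a common point on the segment.
  set A : Set (E d) := ⋃ T' ∈ {T' | (𝒯.starGraph z).Reachable T T'}, hull T'.1.1 with hA
  set B : Set (E d) := ⋃ T' ∈ {T' | ¬ (𝒯.starGraph z).Reachable T T'}, hull T'.1.1 with hB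
  have hAc : IsClosed A := (Set.toFinite _).isClosed_biUnion fun _ _ => isClosed_hull _
  have hBc : IsClosed B := (Set.toFinite _).isClosed_biUnion fun _ _ => isClosed_hull _
  have hpre := isPreconnected_closed_iff.1 (convex_segment p w).isPreconnected A B hAc hBc
    (fun x hx => by
      obtain ⟨T', hT'⟩ := hseg x hx
      by_cases h : (𝒯.starGraph z).Reachable T T'
      · exact .inl (mem_biUnion (show T' ∈ {T' | _} from h) hT')
      · exact .inr (mem_biUnion (show T' ∈ {T' | _} from h) hT'))
    ⟨p, left_mem_segment ℝ p w, mem_biUnion (SimpleGraph.Reachable.refl T : T ∈ {T' | _}) hp⟩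
    ⟨w, right_mem_segment ℝ p w, mem_biUnion (show Tw ∈ {T' | _} from hcon) hw⟩
  obtain ⟨x, hx, hxA, hxB⟩ := hpre
  obtain ⟨T₁, h₁, hx₁⟩ := mem_iUnion₂.1 hxA
  obtain ⟨T₂, h₂, hx₂⟩ := mem_iUnion₂.1 hxB
  have hne : T₁ ≠ T₂ := by rintro rfl; exact h₂ h₁
  set F := T₁.1.1 ∩ T₂.1.1 with hF
  have hzF : z ∈ F := Finset.mem_inter.2 ⟨T₁.2, T₂.2⟩
  have hxF : x ∈ hull F := inter_hull_subset T₁.1.2.1 T₂.1.2.1 ⟨hx₁, hx₂⟩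
  have hFf : F ∈ 𝒯.faces := 𝒯.down_closed T₁.1.2.1 Finset.inter_subset_left ⟨z, hzF⟩
  have hcard : F.card ≤ d := by
    by_contra! hlt
    refine hne (Subtype.ext (eq_of_subset ?_))
    have := Finset.eq_of_subset_of_card_le (Finset.inter_subset_left : F ⊆ T₁.1.1)
      (by rw [T₁.1.2.2]; exact hlt)
    rw [← this]
    exact Finset.inter_subset_right
  rcases hcard.eq_or_lt with hc | hc
  · have hadj : (𝒯.starGraph z).Adj T₁ T₂ :=
      ⟨hne, F, hc, hzF, Finset.inter_subset_left, Finset.inter_subset_right⟩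
    exact h₂ (SimpleGraph.Reachable.trans h₁ hadj.reachable)
  -- The segment meets a face of codimension at least two, so `w` lies in the span of it and `p`.
  · have hxs : x ∈ affineSpan ℝ (F : Set (E d)) := convexHull_subset_affineSpan _ hxF
    rw [segment_eq_image_lineMap] at hx
    obtain ⟨t, -, rfl⟩ := hx
    rcases eq_or_ne t 0 with rfl | ht
    · rw [AffineMap.lineMap_apply_zero] at hxs
      exact hpF F hFf hcard hxs
    · refine hwF F hFf hc ?_
      set x := AffineMap.lineMap p w t with hxdef
      have e : w = AffineMap.lineMap p x t⁻¹ := by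
        rw [hxdef, AffineMap.lineMap_apply, AffineMap.lineMap_apply]
        simp [smul_smul, ht]
      rw [e]
      exact AffineMap.lineMap_mem _ (mem_affineSpan ℝ (mem_insert _ _))
        (affineSpan_mono ℝ (subset_insert _ _) hxs)

/-- The union of the elements at `z` is, near `z`, star-shaped with respect to all points of an open
cone with apex `z`, so that elements are joined by generic segments to an element in this cone. -/
theorem starGraph_reachable (hΩ : IsLipschitzDomain Ω) {z : E d}
    (T T' : {T : 𝒯.Elem // z ∈ T.1}) : (𝒯.starGraph z).Reachable T T' := by
  classical
  have hzc : z ∈ closure Ω := hull_subset_closure T.1 (subset_hull _ T.2)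
  obtain ⟨r₁, hr₁, K, hKo, ⟨k₀, hk₀⟩, hKs, hKz, hKΩ⟩ := hΩ.exists_cone hzc
  obtain ⟨r₂, hr₂, hloc⟩ := Metric.eventually_nhds_iff.1 (eventually_mem_of_mem_hull T.2)
  set r := min r₁ r₂ with hr
  have hr0 : 0 < r := lt_min hr₁ hr₂
  have hgen : ∀ T : {T : 𝒯.Elem // z ∈ T.1}, ∃ p ∈ interior (hull T.1.1) ∩ Metric.ball z r,
      ∀ F ∈ {F | F ∈ 𝒯.faces ∧ F.card ≤ d}, p ∉ affineSpan ℝ (F : Set (E d)) := by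
    intro T
    refine exists_mem_forall_notMem (isOpen_interior.inter Metric.isOpen_ball) ?_ _
      (𝒯.finite_faces.subset fun _ h => h.1) _ fun F hF => affineSpan_ne_top_of_card_le hF.2
    have : z ∈ closure (interior (hull T.1.1)) := by
      rw [closure_interior_hull]; exact subset_hull _ T.2
    obtain ⟨x, hx, hx'⟩ := Metric.mem_closure_iff.1 this r hr0
    exact ⟨x, hx, by rwa [Metric.mem_ball, dist_comm]⟩
  obtain ⟨p, ⟨hpi, hpr⟩, hpF⟩ := hgen T
  obtain ⟨p', ⟨hpi', hpr'⟩, hpF'⟩ := hgen T'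
  set U : Set (E d) := (fun w => w - z) ⁻¹' (K ∩ Metric.ball 0 r) with hU
  have hUo : IsOpen U := (hKo.inter Metric.isOpen_ball).preimage (by fun_prop)
  have hUne : U.Nonempty := by
    have hc : Continuous fun t : ℝ => ‖t • k₀‖ := by fun_prop
    have h1 : ∀ᶠ t in 𝓝[>] (0 : ℝ), ‖t • k₀‖ < r :=
      ((hc.tendsto 0).eventually (gt_mem_nhds (by simpa using hr0))).filter_mono
        nhdsWithin_le_nhds
    obtain ⟨t, ht, ht0⟩ := (h1.and self_mem_nhdsWithin).exists
    exact ⟨z + t • k₀, by simpa [hU] using ⟨hKs k₀ hk₀ t ht0, ht⟩⟩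
  -- A single generic point `w` of the cone serves both elements.
  obtain ⟨w, hwU, hwF⟩ := exists_mem_forall_notMem hUo hUne
    {q : E d × Finset (E d) | q ∈ ({p, p'} : Set (E d)) ×ˢ {F | F ∈ 𝒯.faces ∧ F.card < d}}
    ((Set.toFinite _).prod (𝒯.finite_faces.subset fun _ h => h.1))
    (fun q => affineSpan ℝ (insert q.1 (q.2 : Set (E d)))) (by
      rintro ⟨q, F⟩ ⟨-, -, hF⟩
      rw [← Finset.coe_insert]
      exact affineSpan_ne_top_of_card_le ((Finset.card_insert_le _ _).trans hF))
  have hwK : w - z ∈ K := hwU.1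
  have hwr : ‖w - z‖ < r := by simpa using hwU.2
  have hseg : ∀ (T : {T : 𝒯.Elem // z ∈ T.1}) (p : E d), p ∈ interior (hull T.1.1) →
      p ∈ Metric.ball z r →
      ∀ x ∈ segment ℝ p w, ∃ T : {T : 𝒯.Elem // z ∈ T.1}, x ∈ hull T.1.1 := by
    intro T p hp hpr x hx
    have hxr : x ∈ Metric.ball z r := (convex_ball z r).segment_subset hpr
      (by simpa [Metric.mem_ball, dist_eq_norm] using hwr) hx
    have hxΩ : x ∈ Ω := by
      obtain ⟨s, t, hs, ht, hst, rfl⟩ := hx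
      rcases hs.eq_or_lt with rfl | hs0
      · have : t = 1 := by linarith
        subst this
        have := hKz _ hwK (hwr.trans_le (min_le_left _ _))
        simpa using this
      rcases ht.eq_or_lt with rfl | ht0
      · have : s = 1 := by linarith
        subst this
        simpa using interior_hull_subset hΩ T.1 hp
      -- A point of the segment is a point of `T` translated by a vector of the cone.
      · have h1 : s • p + t • z ∈ interior (hull T.1.1) :=
          (convex_hull T.1.1).combo_interior_self_mem_interior hp (subset_hull _ T.2) hs0 ht hst
        have h2 : s • p + t • z ∈ Metric.ball z r := (convex_ball z r) hpr
          (Metric.mem_ball_self hr0) hs ht hst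
        have e : s • p + t • w = s • p + t • z + t • (w - z) := by
          rw [smul_sub]; abel
        rw [e] at hxr ⊢
        rw [Metric.mem_ball, dist_eq_norm] at h2 hxr
        exact hKΩ _ (interior_hull_subset hΩ T.1 h1) (h2.trans_le (min_le_left _ _)) _
          (hKs _ hwK t ht0) (hxr.trans_le (min_le_left _ _))
    obtain ⟨Tx, hTx⟩ := exists_mem_hull (𝒯 := 𝒯) (subset_closure hxΩ)
    exact ⟨⟨Tx, hloc ((Metric.mem_ball.1 hxr).trans_le (min_le_right _ _)) Tx hTx⟩, hTx⟩
  obtain ⟨Tw, hTw⟩ := hseg T p hpi hpr w (right_mem_segment ℝ p w)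
  refine SimpleGraph.Reachable.trans (v := Tw) ?_ (SimpleGraph.Reachable.symm ?_)
  · exact reachable_of_segment (interior_subset hpi) hTw (fun F hF hc => hpF F ⟨hF, hc⟩)
      (fun F hF hc => hwF (p, F) ⟨by simp, hF, hc⟩) (hseg T p hpi hpr)
  · exact reachable_of_segment (interior_subset hpi') hTw (fun F hF hc => hpF' F ⟨hF, hc⟩)
      (fun F hF hc => hwF (p', F) ⟨by simp, hF, hc⟩) (hseg T' p' hpi' hpr')

end Triangulation

end FEM

namespace FEM.Triangulation

variable {d : ℕ} {Ω : Set (E d)} {𝒯 : Triangulation Ω}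

/-! ### Gradients of affine functions and the size of simplices -/

theorem apply_sub_apply (f : E d →ᵃ[ℝ] ℝ) (x y : E d) :
    f x - f y = inner ℝ (affGrad f) (x - y) := by
  have h : f.linear (x - y) = f x - f y := by
    simpa using f.linearMap_vsub x y
  rw [← h, affGrad, InnerProductSpace.toDual_symm_apply]
  rfl

theorem abs_apply_sub_apply_le (f : E d →ᵃ[ℝ] ℝ) (x y : E d) :
    |f x - f y| ≤ ‖affGrad f‖ * ‖x - y‖ := by
  rw [apply_sub_apply]
  exact abs_real_inner_le_norm _ _

theorem affGrad_sub (f g : E d →ᵃ[ℝ] ℝ) : affGrad (f - g) = affGrad f - affGrad g := by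
  simp [affGrad]

theorem isBounded_hull (s : Finset (E d)) : Bornology.IsBounded (hull s) :=
  (isCompact_hull s).isBounded

theorem norm_sub_le_meshSize {s : Finset (E d)} {x y : E d} (hx : x ∈ hull s) (hy : y ∈ hull s) :
    ‖x - y‖ ≤ meshSize s := by
  rw [← dist_eq_norm]
  exact Metric.dist_le_diam_of_mem (isBounded_hull s) hx hy

theorem meshSize_nonneg (s : Finset (E d)) : 0 ≤ meshSize s := Metric.diam_nonneg

theorem meshSize_mono {s t : Finset (E d)} (h : s ⊆ t) : meshSize s ≤ meshSize t :=
  Metric.diam_mono (hull_mono h) (isBounded_hull t)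

/-- An affine function varies on a ball by the norm of its gradient times the diameter. -/
theorem norm_affGrad_mul_inballDiam_le {s : Finset (E d)} (hs : s.Nonempty) (f : E d →ᵃ[ℝ] ℝ)
    {M : ℝ} (h : ∀ x ∈ hull s, ∀ y ∈ hull s, f x - f y ≤ M) :
    ‖affGrad f‖ * inballDiam s ≤ M := by
  obtain ⟨z, hz⟩ := hs
  have hz' : z ∈ hull s := subset_hull s hz
  rcases (norm_nonneg (affGrad f)).eq_or_lt with h0 | h0
  · rw [← h0, zero_mul]
    simpa using h z hz' z hz'
  · rw [mul_comm, ← le_div_iff₀ h0]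
    refine csSup_le ⟨0, le_rfl, z, by simpa using hz'⟩ ?_
    rintro δ ⟨hδ, x, hx⟩
    rw [le_div_iff₀ h0]
    set g := affGrad f
    set u := (δ / 2 / ‖g‖) • g with hu
    have hnu : ‖u‖ = δ / 2 := by
      rw [hu, norm_smul, Real.norm_of_nonneg (by positivity)]
      field_simp
    have h1 := h (x + u) (hx (by simp [hnu])) (x - u) (hx (by simp [hnu]))
    rw [apply_sub_apply, show x + u - (x - u) = (2 : ℝ) • u by rw [two_smul]; abel,
      inner_smul_right, hu, inner_smul_right, real_inner_self_eq_norm_sq] at h1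
    calc δ * ‖g‖ = 2 * (δ / 2 / ‖g‖ * ‖g‖ ^ 2) := by field_simp
      _ ≤ M := h1

theorem inballDiam_nonneg (s : Finset (E d)) : 0 ≤ inballDiam s :=
  Real.sSup_nonneg fun _ h => h.1

/-- The largest ball in an element is not larger than any of its edges: apply
`norm_affGrad_mul_inballDiam_le` to a barycentric coordinate. -/
theorem inballDiam_le_norm_sub (T : 𝒯.Elem) {z y : E d} (hz : z ∈ T.1) (hy : y ∈ T.1)
    (hzy : z ≠ y) : inballDiam T.1 ≤ ‖z - y‖ := by
  classical
  have h1 : ∀ w ∈ T.1, 𝒯.nodal z T w ∈ Icc (0 : ℝ) 1 := fun w hw => by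
    rw [nodal_apply_vertex z hw]; split_ifs <;> simp
  have h2 : ∀ w ∈ hull T.1, 𝒯.nodal z T w ∈ Icc (0 : ℝ) 1 := fun w hw =>
    convexHull_min (s := (T.1 : Set (E d))) (t := 𝒯.nodal z T ⁻¹' Icc 0 1) h1
      ((convex_Icc _ _).affine_preimage _) hw
  have h3 := norm_affGrad_mul_inballDiam_le (nonempty T) (𝒯.nodal z T) (M := 1)
    fun x hx y hy => by linarith [(h2 x hx).2, (h2 y hy).1]
  have h4 := abs_apply_sub_apply_le (𝒯.nodal z T) z y
  rw [nodal_apply_vertex z hz, nodal_apply_vertex z hy, if_pos rfl, if_neg hzy.symm, sub_zero,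
    abs_one] at h4
  have h5 := inballDiam_nonneg T.1
  have h6 := norm_nonneg (z - y)
  calc inballDiam T.1 = inballDiam T.1 * 1 := by ring
    _ ≤ inballDiam T.1 * (‖affGrad (𝒯.nodal z T)‖ * ‖z - y‖) := by gcongr
    _ = ‖affGrad (𝒯.nodal z T)‖ * inballDiam T.1 * ‖z - y‖ := by ring
    _ ≤ 1 * ‖z - y‖ := by gcongr
    _ = _ := one_mul _

theorem inballDiam_le_of_two_mem (T : 𝒯.Elem) {S : Finset (E d)} (hT : S ⊆ T.1)
    (hS : 2 ≤ S.card) : inballDiam T.1 ≤ meshSize S := by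
  obtain ⟨z, hz, y, hy, hzy⟩ := Finset.one_lt_card.1 hS
  exact (inballDiam_le_norm_sub T (hT hz) (hT hy) hzy).trans
    (norm_sub_le_meshSize (subset_hull S hz) (subset_hull S hy))

theorem meshSize_pos (hd : 1 ≤ d) (T : 𝒯.Elem) : 0 < meshSize T.1 := by
  obtain ⟨z, hz, y, hy, hzy⟩ := Finset.one_lt_card.1 (by rw [T.2.2]; omega : 1 < T.1.card)
  exact (norm_pos_iff.2 (sub_ne_zero.2 hzy)).trans_le
    (norm_sub_le_meshSize (subset_hull _ hz) (subset_hull _ hy))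

variable {κ : ℝ}

theorem inballDiam_pos (hd : 1 ≤ d) (hκ : 𝒯.IsShapeRegular κ) (T : 𝒯.Elem) :
    0 < inballDiam T.1 := by
  have h := (meshSize_pos hd T).trans_le (hκ T)
  refine (inballDiam_nonneg T.1).lt_of_ne fun h0 => ?_
  rw [← h0, mul_zero] at h
  exact lt_irrefl _ h

theorem one_le_shape (hd : 1 ≤ d) (hκ : 𝒯.IsShapeRegular κ) (T : 𝒯.Elem) : 1 ≤ κ := by
  have h1 := inballDiam_le_of_two_mem T (Finset.Subset.refl _) (by rw [T.2.2]; omega)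
  have h2 := hκ T
  have h3 := inballDiam_pos hd hκ T
  by_contra! h
  nlinarith

/-- The supremum in the definition of `ρ_T` need not be known to be attained: a ball of half of
this diameter suffices. -/
theorem exists_closedBall_subset (hd : 1 ≤ d) (hκ : 𝒯.IsShapeRegular κ) (T : 𝒯.Elem) :
    ∃ x, Metric.closedBall x (meshSize T.1 / (4 * κ)) ⊆ hull T.1 := by
  have h3 := inballDiam_pos hd hκ T
  have hκ0 : 0 < κ := one_pos.trans_le (one_le_shape hd hκ T)
  obtain ⟨z, hz⟩ := nonempty T
  obtain ⟨δ, ⟨hδ, x, hx⟩, hlt⟩ := exists_lt_of_lt_csSup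
    (s := {δ : ℝ | 0 ≤ δ ∧ ∃ x, Metric.closedBall x (δ / 2) ⊆ hull T.1})
    ⟨0, le_rfl, z, by simpa using subset_hull _ hz⟩ (half_lt_self h3)
  refine ⟨x, (Metric.closedBall_subset_closedBall ?_).trans hx⟩
  rw [div_le_iff₀ (by positivity)]
  have hlt : inballDiam T.1 / 2 < δ := hlt
  have h5 : κ * (inballDiam T.1 / 2) ≤ κ * δ := by gcongr
  linarith [hκ T]

/-! ### The number of elements at a vertex -/

/-- Elements have disjoint interiors, so that a ball of radius `R` holds at most `(R / δ) ^ d`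
of them if each contains a ball of radius `δ` inside the large ball. -/
theorem card_mul_pow_le (I : Finset 𝒯.Elem) {z : E d} {R δ : ℝ} (hR : 0 ≤ R) (hδ : 0 < δ)
    (y : 𝒯.Elem → E d) (hy : ∀ T ∈ I, Metric.ball (y T) δ ⊆ hull T.1 ∩ Metric.closedBall z R) :
    I.card * δ ^ d ≤ R ^ d := by
  set ω := (volume : Measure (E d)).real (Metric.ball 0 1) with hω
  have hω0 : 0 < ω :=
    ENNReal.toReal_pos (Metric.measure_ball_pos volume _ one_pos).ne'
      Metric.isBounded_ball.measure_lt_top.ne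
  have h1 : ∀ x : E d, (volume : Measure (E d)).real (Metric.ball x δ) = δ ^ d * ω := by
    intro x
    rw [measureReal_def, Measure.addHaar_ball_of_pos _ _ hδ, ENNReal.toReal_mul,
      ENNReal.toReal_ofReal (by positivity), finrank_euclideanSpace_fin, hω, measureReal_def]
  have h2 := Measure.addHaar_real_closedBall (volume : Measure (E d)) z hR
  rw [finrank_euclideanSpace_fin] at h2
  have hdisj : (I : Set 𝒯.Elem).PairwiseDisjoint fun T => Metric.ball (y T) δ := by
    intro T hT T' hT' hne
    refine Set.disjoint_left.2 fun x hx hx' => hne ?_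
    have : x ∈ interior (hull T.1) :=
      interior_maximal (fun w hw => (hy T hT hw).1) Metric.isOpen_ball hx
    exact eq_of_mem_interior_hull this (hy T' hT' hx').1
  have h3 := measureReal_biUnion_finset (μ := (volume : Measure (E d))) hdisj
    (fun T _ => Metric.isOpen_ball.measurableSet)
    (fun T _ => Metric.isBounded_ball.measure_lt_top.ne)
  simp only [h1, Finset.sum_const, nsmul_eq_mul] at h3
  have h4 : (volume : Measure (E d)).real (⋃ T ∈ I, Metric.ball (y T) δ) ≤ R ^ d * ω := by
    rw [← h2]
    exact measureReal_mono (iUnion₂_subset fun T hT x hx => (hy T hT hx).2)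
      Metric.isBounded_closedBall.measure_lt_top.ne
  rw [h3, ← mul_assoc] at h4
  exact le_of_mul_le_mul_right h4 hω0

/-- A bound, in terms of the shape regularity, for the number of elements at a vertex. -/
def starBound (d : ℕ) (κ : ℝ) : ℕ := ⌈(4 * κ) ^ d⌉₊

/-- The elements at `z`, shrunk towards `z` to a common diameter, all contain balls of a fixed
proportion of this diameter. -/
theorem card_star_le (hd : 1 ≤ d) (hκ : 𝒯.IsShapeRegular κ) (z : E d) (I : Finset 𝒯.Elem)
    (hI : ∀ T ∈ I, z ∈ T.1) : I.card ≤ starBound d κ := by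
  rcases I.eq_empty_or_nonempty with rfl | ⟨T₀, hT₀⟩
  · simp
  have hκ0 : 0 < κ := one_pos.trans_le (one_le_shape hd hκ T₀)
  obtain ⟨Tm, -, hm⟩ := Finset.univ.exists_min_image (fun T : 𝒯.Elem => meshSize T.1)
    ⟨T₀, Finset.mem_univ _⟩
  set ε := meshSize Tm.1 with hε
  have hε0 : 0 < ε := meshSize_pos hd Tm
  choose x hx using fun T : 𝒯.Elem => exists_closedBall_subset hd hκ T
  have key := card_mul_pow_le I (z := z) (R := ε) (δ := ε / (4 * κ)) hε0.le (by positivity)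
    (fun T => z + (ε / meshSize T.1) • (x T - z)) (by
      intro T hT w hw
      have hh := meshSize_pos hd T
      have hs1 : ε / meshSize T.1 ≤ 1 := (div_le_one hh).2 (hm T (Finset.mem_univ _))
      set s := ε / meshSize T.1 with hs
      have hs0 : 0 < s := by positivity
      -- `w` is the image of `w'` under the homothety with center `z` and ratio `s`.
      set w' := z + s⁻¹ • (w - z) with hw'
      have e1 : w = z + s • (w' - z) := by
        rw [hw']; simp [smul_smul, hs0.ne']
      have e2 : w' - x T = s⁻¹ • (w - (z + s • (x T - z))) := by
        rw [hw', ← sub_sub w z, smul_sub _ (w - z), smul_smul, inv_mul_cancel₀ hs0.ne', one_smul]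
        abel
      have hmem : w' ∈ hull T.1 := by
        refine hx T ?_
        rw [Metric.mem_closedBall, dist_eq_norm, e2, norm_smul, norm_inv,
          Real.norm_of_nonneg hs0.le]
        rw [Metric.mem_ball, dist_eq_norm] at hw
        calc s⁻¹ * ‖w - (z + s • (x T - z))‖ ≤ s⁻¹ * (ε / (4 * κ)) := by gcongr
          _ = meshSize T.1 / (4 * κ) := by rw [hs]; field_simp
      have hzT : z ∈ hull T.1 := subset_hull _ (hI T hT)
      constructor
      · rw [e1]
        have := (convex_hull T.1) hzT hmem (sub_nonneg.2 hs1) hs0.le (by ring)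
        convert this using 1
        rw [sub_smul, one_smul, smul_sub]; abel
      · rw [Metric.mem_closedBall, dist_eq_norm, e1, add_sub_cancel_left, norm_smul,
          Real.norm_of_nonneg hs0.le]
        calc s * ‖w' - z‖ ≤ s * meshSize T.1 := by
              gcongr; exact norm_sub_le_meshSize hmem hzT
          _ = ε := by rw [hs]; field_simp)
  rw [div_pow, ← mul_div_assoc, div_le_iff₀ (by positivity), mul_comm] at key
  have : (I.card : ℝ) ≤ (4 * κ) ^ d := le_of_mul_le_mul_left key (by positivity)
  exact_mod_cast this.trans (Nat.le_ceil _)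

instance (z : E d) : Fintype {T : 𝒯.Elem // z ∈ T.1} := Fintype.ofFinite _

theorem card_star_subtype_le (hd : 1 ≤ d) (hκ : 𝒯.IsShapeRegular κ) (z : E d) :
    Fintype.card {T : 𝒯.Elem // z ∈ T.1} ≤ starBound d κ := by
  classical
  rw [← Finset.card_univ, ← Finset.card_map (Function.Embedding.subtype _)]
  refine card_star_le hd hκ z _ fun T hT => ?_
  obtain ⟨T', -, rfl⟩ := Finset.mem_map.1 hT
  exact T'.2

/-! ### Chains of elements at a vertex -/

theorem abs_sub_le_of_walk {V : Type*} {G : SimpleGraph V} {f : V → ℝ} {M : ℝ}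
    (h : ∀ u v, G.Adj u v → |f u - f v| ≤ M) {u v : V} (p : G.Walk u v) :
    |f u - f v| ≤ p.length * M := by
  induction p with
  | nil => simp
  | cons hadj p ih =>
    rw [SimpleGraph.Walk.length_cons]
    push_cast
    have := abs_sub_le (f _) (f _) (f _) |>.trans (add_le_add (h _ _ hadj) ih)
    linarith

theorem le_pow_mul_of_walk {V : Type*} {G : SimpleGraph V} {f : V → ℝ} {M : ℝ} (hM : 0 ≤ M)
    (h : ∀ u v, G.Adj u v → f u ≤ M * f v) {u v : V} (p : G.Walk u v) :
    f u ≤ M ^ p.length * f v := by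
  induction p with
  | nil => simp
  | cons hadj p ih =>
    rw [SimpleGraph.Walk.length_cons, pow_succ', mul_assoc]
    exact (h _ _ hadj).trans (by gcongr)

theorem exists_walk_length_le (hd : 1 ≤ d) (hκ : 𝒯.IsShapeRegular κ) (hΩ : IsLipschitzDomain Ω)
    {z : E d} (T T' : {T : 𝒯.Elem // z ∈ T.1}) :
    ∃ p : (𝒯.starGraph z).Walk T T', p.length ≤ starBound d κ := by
  classical
  obtain ⟨p⟩ := starGraph_reachable hΩ T T'
  exact ⟨p.toPath, p.toPath.2.length_lt.le.trans (card_star_subtype_le hd hκ z)⟩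

/-- A bound for the ratio of the diameters of elements which touch each other, for `d ≥ 2`: a
factor `κ` for each step of a chain. -/
def sizeRatio (d : ℕ) (κ : ℝ) : ℝ := κ ^ starBound d κ

/-- In a chain of elements at a vertex, consecutive elements have a common edge, which is at least
as long as the diameter of the largest ball in either of them. This needs `d ≥ 2`, where sides have
edges. -/
theorem meshSize_le_of_common_vertex (hd : 2 ≤ d) (hκ : 𝒯.IsShapeRegular κ)
    (hΩ : IsLipschitzDomain Ω) {z : E d} {T T' : 𝒯.Elem} (hz : z ∈ T.1) (hz' : z ∈ T'.1) :
    meshSize T.1 ≤ sizeRatio d κ * meshSize T'.1 := by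
  have hκ1 := one_le_shape (by omega) hκ T
  obtain ⟨p, hp⟩ := exists_walk_length_le (by omega) hκ hΩ
    (⟨T, hz⟩ : {T : 𝒯.Elem // z ∈ T.1}) ⟨T', hz'⟩
  have h := le_pow_mul_of_walk (f := fun T : {T : 𝒯.Elem // z ∈ T.1} => meshSize T.1.1)
    (M := κ) (by linarith) (by
      rintro u v ⟨-, S, hS, -, h1, h2⟩
      calc meshSize u.1.1 ≤ κ * inballDiam u.1.1 := hκ u.1
        _ ≤ κ * meshSize S := by
          gcongr
          exact inballDiam_le_of_two_mem u.1 h1 (by omega)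
        _ ≤ κ * meshSize v.1.1 := by
          gcongr
          exact meshSize_mono h2) p
  refine h.trans ?_
  have := meshSize_nonneg T'.1
  rw [sizeRatio]
  gcongr

/-! ### The patch of an element -/

/-- `T'` touches `T`, that is, `T'` belongs to the patch of `T`. -/
def Touches (T' T : 𝒯.Elem) : Prop := (hull T'.1 ∩ hull T.1).Nonempty

theorem touches_of_mem {T' T : 𝒯.Elem} {z : E d} (h' : z ∈ T'.1) (h : z ∈ T.1) : Touches T' T :=
  ⟨z, subset_hull _ h', subset_hull _ h⟩

theorem Touches.exists_vertex {T' T : 𝒯.Elem} (h : Touches T' T) : ∃ z, z ∈ T'.1 ∧ z ∈ T.1 :=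
  exists_common_vertex T'.2.1 T.2.1 h

theorem mem_patch {T : 𝒯.Elem} {x : E d} :
    x ∈ 𝒯.patch T ↔ ∃ T' : 𝒯.Elem, Touches T' T ∧ x ∈ hull T'.1 := by
  simp [patch, Touches]

theorem hull_subset_patch {T' T : 𝒯.Elem} (h : Touches T' T) : hull T'.1 ⊆ 𝒯.patch T :=
  fun _ hx => mem_patch.2 ⟨T', h, hx⟩

open Classical in
theorem card_touches_le (hd : 1 ≤ d) (hκ : 𝒯.IsShapeRegular κ) (T : 𝒯.Elem) :
    (Finset.univ.filter fun T' : 𝒯.Elem => Touches T' T).card ≤ (d + 1) * starBound d κ := by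
  have h : (Finset.univ.filter fun T' : 𝒯.Elem => Touches T' T) ⊆
      T.1.biUnion fun z => Finset.univ.filter fun T' : 𝒯.Elem => z ∈ T'.1 := by
    intro T' hT'
    obtain ⟨z, hz', hz⟩ := (Finset.mem_filter.1 hT').2.exists_vertex
    exact Finset.mem_biUnion.2 ⟨z, hz, by simpa using hz'⟩
  refine (Finset.card_le_card h).trans ((Finset.card_biUnion_le_card_mul _ _ (starBound d κ)
    fun z _ => ?_).trans (by rw [T.2.2]))
  exact card_star_le hd hκ z _ fun T hT => (Finset.mem_filter.1 hT).2

theorem mem_patchSides {ΓD : Set (E d)} {T : 𝒯.Elem} {S : Finset (E d)} :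
    S ∈ 𝒯.patchSides ΓD T ↔ S ∈ 𝒯.sides ∧ ((hull S ∩ interior (𝒯.patch T)).Nonempty ∨
      (hull S ⊆ ΓD ∧ (hull S ∩ hull T.1).Nonempty)) := by
  simp [patchSides]

/-- All elements with a side in `𝒮_h(T)` belong to the patch of `T`. -/
theorem touches_of_mem_patchSides {ΓD : Set (E d)} {T T' : 𝒯.Elem} {S : Finset (E d)}
    (hS : S ∈ 𝒯.patchSides ΓD T) (hT' : S ⊆ T'.1) : Touches T' T := by
  rcases (mem_patchSides.1 hS).2 with ⟨x, hxS, hxi⟩ | ⟨-, x, hxS, hxT⟩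
  · have hx : x ∈ closure (interior (hull T'.1)) := by
      rw [closure_interior_hull]; exact hull_mono hT' hxS
    obtain ⟨y, hy1, hy2⟩ := mem_closure_iff.1 hx _ isOpen_interior hxi
    obtain ⟨T'', hT'', hy⟩ := mem_patch.1 (interior_subset hy1)
    rwa [eq_of_mem_interior_hull hy2 hy]
  · exact ⟨x, hull_mono hT' hxS, hxT⟩

/-- A bound for the number of sides in `𝒮_h(T)`. -/
def sideBound (d : ℕ) (κ : ℝ) : ℕ := (d + 1) * starBound d κ * (d + 1)

theorem card_patchSides_le (hd : 1 ≤ d) (hκ : 𝒯.IsShapeRegular κ) (ΓD : Set (E d)) (T : 𝒯.Elem) :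
    (𝒯.patchSides ΓD T).card ≤ sideBound d κ := by
  classical
  have h : 𝒯.patchSides ΓD T ⊆ (Finset.univ.filter fun T' : 𝒯.Elem => Touches T' T).biUnion
      fun T' => T'.1.powersetCard d := by
    intro S hS
    obtain ⟨T', hT', hc⟩ := mem_sides.1 (mem_patchSides.1 hS).1
    exact Finset.mem_biUnion.2 ⟨T', by simpa using touches_of_mem_patchSides hS hT',
      Finset.mem_powersetCard.2 ⟨hT', hc⟩⟩
  refine (Finset.card_le_card h).trans ((Finset.card_biUnion_le_card_mul _ _ (d + 1)
    fun T' _ => ?_).trans (Nat.mul_le_mul_right _ (card_touches_le hd hκ T)))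
  rw [Finset.card_powersetCard, T'.2.2, Nat.choose_succ_self_right]

/-- The interior sides at a vertex of `T` belong to `𝒮_h(T)`. -/
theorem mem_patchSides_of_common_side (hd : 1 ≤ d) {ΓD : Set (E d)} {T T₁ T₂ : 𝒯.Elem}
    (hne : T₁ ≠ T₂) {S : Finset (E d)} (hS : S.card = d) (h₁ : S ⊆ T₁.1) (h₂ : S ⊆ T₂.1)
    (ht₁ : Touches T₁ T) (ht₂ : Touches T₂ T) : S ∈ 𝒯.patchSides ΓD T :=
  mem_patchSides.2 ⟨mem_sides.2 ⟨T₁, h₁, hS⟩, .inl ⟨midpoint S, midpoint_mem_hull hd hS,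
    interior_mono (union_subset (hull_subset_patch ht₁) (hull_subset_patch ht₂))
      (midpoint_mem_interior hd hne hS h₁ h₂)⟩⟩

/-- A common side of two elements is not contained in the boundary, since its barycenter is an
interior point of the closure of the domain. -/
theorem not_isBoundarySide (hΩ : IsLipschitzDomain Ω) (hd : 1 ≤ d) {T₁ T₂ : 𝒯.Elem}
    (hne : T₁ ≠ T₂) {S : Finset (E d)} (hS : S.card = d) (h₁ : S ⊆ T₁.1) (h₂ : S ⊆ T₂.1) :
    ¬ 𝒯.IsBoundarySide S := fun h =>
  hΩ.notMem_interior_closure (h (midpoint_mem_hull hd hS))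
    (interior_mono (union_subset (hull_subset_closure T₁) (hull_subset_closure T₂))
      (midpoint_mem_interior hd hne hS h₁ h₂))

end FEM.Triangulation

namespace FEM

/-! ### The integral of an affine function over a simplex -/

section Simplex

theorem affineMap_sum_apply {ι V : Type*} [AddCommGroup V] [Module ℝ V] (s : Finset ι)
    (g : ι → V →ᵃ[ℝ] ℝ) (x : V) : (∑ i ∈ s, g i) x = ∑ i ∈ s, g i x :=
  map_sum (⟨⟨fun f => f x, rfl⟩, fun _ _ => rfl⟩ : (V →ᵃ[ℝ] ℝ) →+ ℝ) g s

variable {V : Type*} [NormedAddCommGroup V] [NormedSpace ℝ V]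
  {ι : Type*} [Fintype ι] (b : AffineBasis ι ℝ V)

open Classical in
/-- The affine involution which exchanges the vertices `b i` and `b j`. -/
def swapMap (i j : ι) (x : V) : V := x + (b.coord i x - b.coord j x) • (b j - b i)

open Classical in
theorem coord_swapMap (i j k : ι) (x : V) :
    b.coord k (swapMap b i j x) = b.coord (Equiv.swap i j k) x := by
  have h1 : ∀ (x : V) (c : ℝ), b.coord k (x + c • (b j - b i)) =
      b.coord k x + c * (b.coord k (b j) - b.coord k (b i)) := by
    intro x c
    have h2 : (b.coord k).linear (b j - b i) = b.coord k (b j) - b.coord k (b i) := by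
      simpa using (b.coord k).linearMap_vsub (b j) (b i)
    have h3 := (b.coord k).map_vadd x (c • (b j - b i))
    rw [vadd_eq_add, vadd_eq_add, map_smul, h2, smul_eq_mul] at h3
    rw [add_comm, h3, add_comm]
  rw [swapMap, h1, b.coord_apply, b.coord_apply]
  rcases eq_or_ne k i with rfl | hki
  · rcases eq_or_ne k j with rfl | hkj
    · simp
    · simp [hkj]
  · rcases eq_or_ne k j with rfl | hkj
    · simp [hki]
    · simp [hki, hkj, Equiv.swap_apply_of_ne_of_ne]

theorem swapMap_involutive (i j : ι) : Function.Involutive (swapMap b i j) := by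
  classical
  intro x
  refine b.ext_elem fun k => ?_
  rw [coord_swapMap, coord_swapMap, Equiv.swap_apply_self]

variable [FiniteDimensional ℝ V] [MeasurableSpace V] [BorelSpace V] (μ : Measure V)
  [μ.IsAddHaarMeasure]

/-- An affine involution preserves Haar measure, because its determinant is `1` or `-1`. -/
theorem measurePreserving_swapMap (i j : ι) : MeasurePreserving (swapMap b i j) μ μ := by
  classical
  set ℓ : V →ᵃ[ℝ] ℝ := b.coord i - b.coord j with hℓ
  set w := b j - b i with hw
  set A : V →ₗ[ℝ] V := LinearMap.id + ℓ.linear.smulRight w with hA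
  set c := ℓ 0 • w with hc
  have hg : swapMap b i j = (fun x => x + c) ∘ A := by
    funext x
    have h : ℓ x = ℓ.linear x + ℓ 0 := congrFun ℓ.decomp x
    have h' : b.coord i x - b.coord j x = ℓ x := rfl
    simp only [swapMap, Function.comp, hA, LinearMap.add_apply, LinearMap.id_apply,
      LinearMap.smulRight_apply, hc]
    rw [h', h, add_smul, ← add_assoc]
  have hAA : A * A = 1 := by
    ext x
    have h1 := swapMap_involutive b i j x
    have h2 := swapMap_involutive b i j 0
    simp only [hg, Function.comp, map_add, map_zero, zero_add] at h1 h2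
    have h3 : A (A x) = x := by
      have : A (A x) + (A c + c) = x := by rw [← add_assoc]; exact h1
      rwa [h2, add_zero] at this
    simpa using h3
  have hdet : |LinearMap.det A| = 1 := by
    have h := congrArg LinearMap.det hAA
    rw [map_mul, map_one] at h
    rcases mul_self_eq_one_iff.1 h with h | h <;> simp [h]
  have hA' : MeasurePreserving A μ μ := by
    refine ⟨A.continuous_of_finiteDimensional.measurable, ?_⟩
    rw [Measure.map_linearMap_addHaar_eq_smul_addHaar μ
      (by rw [← abs_ne_zero, hdet]; exact one_ne_zero), abs_inv, hdet]
    simp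
  rw [hg]
  exact (measurePreserving_add_right μ c).comp hA'

/-- The simplex is invariant under the exchange of two vertices, which exchanges the barycentric
coordinates. -/
theorem setIntegral_coord_eq (i j : ι) :
    ∫ x in convexHull ℝ (range b), b.coord i x ∂μ =
      ∫ x in convexHull ℝ (range b), b.coord j x ∂μ := by
  classical
  have hp := measurePreserving_swapMap b μ i j
  have he : MeasurableEmbedding (swapMap b i j) :=
    (MeasurableEquiv.ofInvolutive _ (swapMap_involutive b i j) hp.measurable).measurableEmbedding
  have h := hp.setIntegral_preimage_emb he (fun x => b.coord i x) (convexHull ℝ (range b))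
  rw [← h]
  have hpre : swapMap b i j ⁻¹' convexHull ℝ (range b) = convexHull ℝ (range b) := by
    rw [b.convexHull_eq_nonneg_coord]
    ext x
    simp only [mem_preimage, mem_ofPred_eq, coord_swapMap]
    exact (Equiv.swap i j).forall_congr_left.trans (by simp)
  rw [hpre]
  simp only [coord_swapMap, Equiv.swap_apply_left]

theorem integrableOn_convexHull (f : V →ᵃ[ℝ] ℝ) :
    IntegrableOn f (convexHull ℝ (range b)) μ :=
  f.continuous_of_finiteDimensional.continuousOn.integrableOn_compact
    ((finite_range b).isCompact_convexHull ℝ)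

theorem setIntegral_coord (i : ι) :
    ∫ x in convexHull ℝ (range b), b.coord i x ∂μ =
      μ.real (convexHull ℝ (range b)) / Fintype.card ι := by
  have h1 : ∑ j, ∫ x in convexHull ℝ (range b), b.coord j x ∂μ =
      μ.real (convexHull ℝ (range b)) := by
    rw [← integral_finsetSum _ fun j _ => integrableOn_convexHull b μ (b.coord j)]
    simp
  have : Nonempty ι := ⟨i⟩
  rw [Finset.sum_congr rfl fun j _ => setIntegral_coord_eq b μ j i, Finset.sum_const,
    Finset.card_univ, nsmul_eq_mul] at h1
  rw [← h1]
  field_simp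

theorem setIntegral_affine (f : V →ᵃ[ℝ] ℝ) :
    ∫ x in convexHull ℝ (range b), f x ∂μ =
      μ.real (convexHull ℝ (range b)) / Fintype.card ι * ∑ i, f (b i) := by
  classical
  have h : ⇑f = fun x => ∑ i, f (b i) * b.coord i x := by
    have : f = ∑ i, f (b i) • b.coord i := by
      refine AffineMap.ext_on b.tot ?_
      rintro _ ⟨j, rfl⟩
      simp [affineMap_sum_apply, b.coord_apply]
    funext x
    conv_lhs => rw [this]
    simp [affineMap_sum_apply]
  calc ∫ x in convexHull ℝ (range b), f x ∂μ
      = ∫ x in convexHull ℝ (range b), (∑ i, f (b i) * b.coord i x) ∂μ := by rw [← h]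
    _ = ∑ i, f (b i) * (μ.real (convexHull ℝ (range b)) / Fintype.card ι) := by
        rw [integral_finsetSum _ fun i _ => (integrableOn_convexHull b μ (b.coord i)).const_mul _]
        simp_rw [integral_const_mul, setIntegral_coord]
    _ = _ := by rw [← Finset.sum_mul, mul_comm]

end Simplex

section Side

variable {d : ℕ} {S : Finset (E d)}

/-- A simplex of dimension `d - 1` is an isometric copy of a full-dimensional simplex in the
direction of its affine span. -/
theorem exists_affineBasis_of_card (hd : 1 ≤ d) (hS : S.card = d)
    (hi : AffineIndependent ℝ ((↑) : S → E d)) :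
    ∃ (V : Submodule ℝ (E d)) (j : V →ᵃ[ℝ] E d) (b : AffineBasis S ℝ V), Isometry j ∧
      Module.finrank ℝ V = d - 1 ∧ ∀ z : S, j (b z) = z := by
  obtain ⟨p, hp⟩ : S.Nonempty := by rw [← Finset.card_pos]; omega
  set V := vectorSpan ℝ (S : Set (E d)) with hV
  have hVr : V = vectorSpan ℝ (range ((↑) : S → E d)) := by
    rw [Subtype.range_coe_subtype]; rfl
  have hfin : Module.finrank ℝ V = d - 1 := by
    rw [hVr]
    exact hi.finrank_vectorSpan (by rw [Fintype.card_coe, hS]; omega)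
  set j : V →ᵃ[ℝ] E d := V.subtype.toAffineMap + AffineMap.const ℝ V p with hj
  have hjx : ∀ v : V, j v = v + p := fun v => rfl
  set q : S → V := fun z => ⟨z - p, vsub_mem_vectorSpan ℝ z.2 hp⟩ with hq
  have hjq : ∀ z : S, j (q z) = z := fun z => by rw [hjx, hq]; simp
  have hqi : AffineIndependent ℝ q := by
    refine AffineIndependent.of_comp j ?_
    have : j ∘ q = ((↑) : S → E d) := funext hjq
    rwa [this]
  refine ⟨V, j, ⟨q, hqi, ?_⟩, ?_, hfin, hjq⟩
  · rw [hqi.affineSpan_eq_top_iff_card_eq_finrank_add_one, hfin, Fintype.card_coe, hS]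
    omega
  · refine Isometry.of_dist_eq fun v w => ?_
    rw [hjx, hjx, dist_add_right]
    rfl

theorem euclideanHausdorffMeasure_hull_pos (hd : 1 ≤ d) (hS : S.card = d)
    (hi : AffineIndependent ℝ ((↑) : S → E d)) :
    0 < (μHE[d - 1] : Measure (E d)) (Triangulation.hull S) ∧
      (μHE[d - 1] : Measure (E d)) (Triangulation.hull S) < ⊤ := by
  obtain ⟨V, j, b, hj, hV, hb⟩ := exists_affineBasis_of_card hd hS hi
  have hr : j '' range b = (S : Set (E d)) := by
    rw [← range_comp, show j ∘ b = ((↑) : S → E d) from funext hb, Subtype.range_coe_subtype]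
    rfl
  rw [Triangulation.hull, ← hr, ← AffineMap.image_convexHull, hj.euclideanHausdorffMeasure_image,
    ← hV]
  exact ⟨Measure.measure_pos_of_nonempty_interior _ ⟨_, b.centroid_mem_interior_convexHull⟩,
    ((finite_range b).isCompact_convexHull ℝ).measure_lt_top⟩

/-- The mean of an affine function over a side is its value at the barycenter. -/
theorem setIntegral_hull_affine (hd : 1 ≤ d) (hS : S.card = d)
    (hi : AffineIndependent ℝ ((↑) : S → E d)) (f : E d →ᵃ[ℝ] ℝ) :
    ∫ x in Triangulation.hull S, f x ∂μHE[d - 1] =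
      (μHE[d - 1] : Measure (E d)).real (Triangulation.hull S) *
        f (Triangulation.midpoint S) := by
  obtain ⟨V, j, b, hj, hV, hb⟩ := exists_affineBasis_of_card hd hS hi
  have hr : j '' range b = (S : Set (E d)) := by
    rw [← range_comp, show j ∘ b = ((↑) : S → E d) from funext hb, Subtype.range_coe_subtype]
    rfl
  have himg : Triangulation.hull S = j '' convexHull ℝ (range b) := by
    rw [Triangulation.hull, ← hr, ← AffineMap.image_convexHull]
  have hpre : j ⁻¹' Triangulation.hull S = convexHull ℝ (range b) := by
    rw [himg, preimage_image_eq _ hj.injective]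
  have hsub : Triangulation.hull S ⊆ range j := by rw [himg]; exact image_subset_range _ _
  have hmeas : MeasurableSet (Triangulation.hull S) :=
    (Triangulation.isClosed_hull S).measurableSet
  have hemb : MeasurableEmbedding j := hj.isClosedEmbedding.measurableEmbedding
  have h1 := hemb.setIntegral_map (μ := μHE[d - 1]) f (Triangulation.hull S)
  rw [hj.map_euclideanHausdorffMeasure, Measure.restrict_restrict hmeas,
    inter_eq_self_of_subset_left hsub, hpre] at h1
  have h2 := setIntegral_affine b μHE[Module.finrank ℝ V] (f.comp j)
  have h3 : (μHE[d - 1] : Measure (E d)).real (Triangulation.hull S) =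
      (μHE[d - 1] : Measure V).real (convexHull ℝ (range b)) := by
    rw [measureReal_def, measureReal_def, himg, hj.euclideanHausdorffMeasure_image]
  rw [hV] at h2
  rw [h1, h3, Triangulation.apply_midpoint hd hS]
  refine h2.trans ?_
  have h4 : ∑ i, (f.comp j) (b i) = ∑ z ∈ S, f z := by
    rw [← Finset.sum_coe_sort S]
    exact Finset.sum_congr rfl fun z _ => by rw [AffineMap.comp_apply, hb]
  rw [h4, Fintype.card_coe, hS]
  ring

end Side

end FEM

namespace FEM.Triangulation

variable {d : ℕ} {Ω : Set (E d)} {𝒯 : Triangulation Ω} {κ : ℝ}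

/-! ### Jumps -/

theorem jump_of_common {M : Type*} [AddCommGroup M] (w : 𝒯.Elem → M) {S : Finset (E d)}
    (h : ∃ p : 𝒯.Elem × 𝒯.Elem, p.1 ≠ p.2 ∧ S ⊆ p.1.1 ∧ S ⊆ p.2.1) :
    𝒯.jump w S = w h.choose.1 - w h.choose.2 := by
  rw [jump, dif_pos h]

theorem jump_of_single {M : Type*} [AddCommGroup M] (w : 𝒯.Elem → M) {S : Finset (E d)}
    {T : 𝒯.Elem} (hT : S ⊆ T.1) (h : ∀ T' : 𝒯.Elem, S ⊆ T'.1 → T' = T) : 𝒯.jump w S = w T := by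
  have h1 : ¬ ∃ p : 𝒯.Elem × 𝒯.Elem, p.1 ≠ p.2 ∧ S ⊆ p.1.1 ∧ S ⊆ p.2.1 := by
    rintro ⟨p, hne, hp1, hp2⟩
    exact hne ((h _ hp1).trans (h _ hp2).symm)
  have h2 : ∃ T : 𝒯.Elem, S ⊆ T.1 := ⟨T, hT⟩
  rw [jump, dif_neg h1, dif_pos h2, h _ h2.choose_spec]

theorem norm_jump_le {M : Type*} [NormedAddCommGroup M] (w : 𝒯.Elem → M) {S : Finset (E d)}
    {T : 𝒯.Elem} (hT : S ⊆ T.1) :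
    ∃ T' T'' : 𝒯.Elem, S ⊆ T'.1 ∧ S ⊆ T''.1 ∧ ‖𝒯.jump w S‖ ≤ ‖w T'‖ + ‖w T''‖ := by
  by_cases h : ∃ p : 𝒯.Elem × 𝒯.Elem, p.1 ≠ p.2 ∧ S ⊆ p.1.1 ∧ S ⊆ p.2.1
  · refine ⟨h.choose.1, h.choose.2, h.choose_spec.2.1, h.choose_spec.2.2, ?_⟩
    rw [jump_of_common w h]
    exact norm_sub_le _ _
  · refine ⟨T, T, hT, hT, ?_⟩
    rw [jump_of_single w hT fun T' hT' => by
      by_contra hne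
      exact h ⟨(T', T), hne, hT', hT⟩]
    linarith [norm_nonneg (w T)]

theorem affineIndependent_of_subset {T : 𝒯.Elem} {S : Finset (E d)} (hT : S ⊆ T.1) :
    AffineIndependent ℝ ((↑) : S → E d) :=
  (𝒯.indep T.2.1).mono (t := (T.1 : Set (E d))) (by exact_mod_cast hT)

/-- The jump of a Crouzeix-Raviart function across an interior side vanishes at the barycenter of
the side, so that at other points of the side it is bounded by the jump of the gradient. -/
theorem IsCR.abs_sub_le (hd : 1 ≤ d) (hΩ : IsLipschitzDomain Ω) {v : 𝒯.L1} (hv : 𝒯.IsCR v)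
    {T₁ T₂ : 𝒯.Elem} (hne : T₁ ≠ T₂) {S : Finset (E d)} (hS : S.card = d) (h₁ : S ⊆ T₁.1)
    (h₂ : S ⊆ T₂.1) {z : E d} (hz : z ∈ S) :
    |v T₁ z - v T₂ z| ≤ meshSize S * ‖𝒯.jump (𝒯.elemGrad v) S‖ := by
  have hex : ∃ p : 𝒯.Elem × 𝒯.Elem, p.1 ≠ p.2 ∧ S ⊆ p.1.1 ∧ S ⊆ p.2.1 := ⟨(T₁, T₂), hne, h₁, h₂⟩
  have hint := hv S (mem_sides.2 ⟨T₁, h₁, hS⟩) (not_isBoundarySide hΩ hd hne hS h₁ h₂)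
  rw [setIntegral_hull_affine hd hS (affineIndependent_of_subset h₁)] at hint
  have hpos := euclideanHausdorffMeasure_hull_pos hd hS (affineIndependent_of_subset h₁)
  have hmid : 𝒯.jump v S (midpoint S) = 0 :=
    (mul_eq_zero.1 hint).resolve_left (ENNReal.toReal_pos hpos.1.ne' hpos.2.ne).ne'
  have hgrad : affGrad (𝒯.jump v S) = 𝒯.jump (𝒯.elemGrad v) S := by
    rw [jump_of_common v hex, jump_of_common _ hex, affGrad_sub]
    rfl
  have habs : |v T₁ z - v T₂ z| = |𝒯.jump v S z| := by
    rw [jump_of_common v hex]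
    obtain ⟨hne', hp1, hp2⟩ := hex.choose_spec
    rcases eq_or_eq_of_common_side hd hne hS h₁ h₂ hp1 with e1 | e1 <;>
    rcases eq_or_eq_of_common_side hd hne hS h₁ h₂ hp2 with e2 | e2
    · exact absurd (e1.trans e2.symm) hne'
    · rw [e1, e2]; rfl
    · rw [e1, e2, abs_sub_comm]; rfl
    · exact absurd (e1.trans e2.symm) hne'
  have h := abs_apply_sub_apply_le (𝒯.jump v S) z (midpoint S)
  rw [hmid, sub_zero, hgrad, ← habs] at h
  refine h.trans ?_
  rw [mul_comm]
  gcongr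
  exact norm_sub_le_meshSize (subset_hull S hz) (midpoint_mem_hull hd hS)

/-! ### The nodal estimate -/

/-- The sum of the quantities `h_S |⟦∇_h v⟧_S|` over the sides in `𝒮_h(T)`. -/
def jumpSum (𝒯 : Triangulation Ω) (ΓD : Set (E d)) (v : 𝒯.L1) (T : 𝒯.Elem) : ℝ :=
  ∑ S ∈ 𝒯.patchSides ΓD T, meshSize S * ‖𝒯.jump (𝒯.elemGrad v) S‖

theorem le_jumpSum {ΓD : Set (E d)} {v : 𝒯.L1} {T : 𝒯.Elem} {S : Finset (E d)}
    (hS : S ∈ 𝒯.patchSides ΓD T) :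
    meshSize S * ‖𝒯.jump (𝒯.elemGrad v) S‖ ≤ 𝒯.jumpSum ΓD v T :=
  Finset.single_le_sum (f := fun S => meshSize S * ‖𝒯.jump (𝒯.elemGrad v) S‖)
    (fun S _ => mul_nonneg (meshSize_nonneg S) (norm_nonneg _)) hS

theorem jumpSum_nonneg (ΓD : Set (E d)) (v : 𝒯.L1) (T : 𝒯.Elem) : 0 ≤ 𝒯.jumpSum ΓD v T :=
  Finset.sum_nonneg fun S _ => mul_nonneg (meshSize_nonneg S) (norm_nonneg _)

/-- Values at a common vertex are compared along a chain of elements at this vertex, the length of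
which is bounded in terms of the shape regularity. -/
theorem abs_sub_le_jumpSum (hd : 1 ≤ d) (hκ : 𝒯.IsShapeRegular κ) (hΩ : IsLipschitzDomain Ω)
    (ΓD : Set (E d)) {v : 𝒯.L1} (hv : 𝒯.IsCR v) {T T' : 𝒯.Elem} {z : E d} (hz : z ∈ T.1)
    (hz' : z ∈ T'.1) : |v T z - v T' z| ≤ starBound d κ * 𝒯.jumpSum ΓD v T := by
  obtain ⟨p, hp⟩ := exists_walk_length_le hd hκ hΩ
    (⟨T, hz⟩ : {T : 𝒯.Elem // z ∈ T.1}) ⟨T', hz'⟩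
  have h := abs_sub_le_of_walk (f := fun T : {T : 𝒯.Elem // z ∈ T.1} => v T.1 z)
    (M := 𝒯.jumpSum ΓD v T) (by
      rintro T₁ T₂ ⟨hne, S, hS, hzS, h₁, h₂⟩
      have hne' : T₁.1 ≠ T₂.1 := fun h => hne (Subtype.ext h)
      exact (hv.abs_sub_le hd hΩ hne' hS h₁ h₂ hzS).trans
        (le_jumpSum (mem_patchSides_of_common_side hd hne' hS h₁ h₂
          (touches_of_mem T₁.2 hz) (touches_of_mem T₂.2 hz)))) p
  refine h.trans ?_
  have := jumpSum_nonneg ΓD v T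
  gcongr

/-- At a Dirichlet node there is a Dirichlet side, at the barycenter of which the function
vanishes. -/
theorem abs_le_jumpSum_of_mem (hd : 1 ≤ d) (hκ : 𝒯.IsShapeRegular κ) (hΩ : IsLipschitzDomain Ω)
    {ΓD : Set (E d)} (hΓ : ΓD ⊆ frontier Ω) (hR : 𝒯.Resolves ΓD) {v : 𝒯.L1}
    (hv : 𝒯.IsCRD ΓD v) {T : 𝒯.Elem} {z : E d} (hz : z ∈ T.1) (hzD : z ∈ ΓD) :
    |v T z| ≤ (starBound d κ + 1) * 𝒯.jumpSum ΓD v T := by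
  obtain ⟨S, hSs, hzS', hSD⟩ := hR z hzD
  obtain ⟨T', hT', hS⟩ := mem_sides.1 hSs
  have hSne : S.Nonempty := by rw [← Finset.card_pos]; omega
  have hSf : S ∈ 𝒯.faces := 𝒯.down_closed T'.2.1 hT' hSne
  have hzS : z ∈ S := mem_of_mem_hull hSf hz hzS'
  have hSp : S ∈ 𝒯.patchSides ΓD T :=
    mem_patchSides.2 ⟨hSs, .inr ⟨hSD, z, hzS', subset_hull _ hz⟩⟩
  have hj : 𝒯.jump (𝒯.elemGrad v) S = 𝒯.elemGrad v T' := by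
    refine jump_of_single _ hT' fun T'' hT'' => ?_
    by_contra hne
    exact not_isBoundarySide hΩ hd hne hS hT'' hT' (hSD.trans hΓ)
  have h1 := abs_apply_sub_apply_le (v T') z (midpoint S)
  rw [hv.2 S hSs hSD T' hT', sub_zero] at h1
  have h2 : |v T' z| ≤ 𝒯.jumpSum ΓD v T := by
    refine le_trans ?_ (le_jumpSum hSp)
    rw [hj, mul_comm]
    refine h1.trans ?_
    have := norm_sub_le_meshSize (subset_hull S hzS) (midpoint_mem_hull hd hS)
    exact mul_le_mul_of_nonneg_left this (norm_nonneg _)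
  have h3 := abs_sub_le_jumpSum hd hκ hΩ ΓD hv.1 hz (hT' hzS)
  have h4 := abs_sub_le (v T z) (v T' z) 0
  rw [sub_zero, sub_zero] at h4
  linarith

/-- The nodal values of `v - 𝒥_h^{av} v` are controlled by the jumps of the gradient. -/
theorem abs_sub_nodeAvg_le (hd : 1 ≤ d) (hκ : 𝒯.IsShapeRegular κ) (hΩ : IsLipschitzDomain Ω)
    {ΓD : Set (E d)} (hΓ : ΓD ⊆ frontier Ω) (hR : 𝒯.Resolves ΓD) {v : 𝒯.L1}
    (hv : 𝒯.IsCRD ΓD v) {T : 𝒯.Elem} {z : E d} (hz : z ∈ T.1) :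
    |v T z - 𝒯.nodeAvg ΓD v z| ≤ (starBound d κ + 1) * 𝒯.jumpSum ΓD v T := by
  classical
  by_cases hzD : z ∈ ΓD
  · rw [nodeAvg, if_pos hzD, sub_zero]
    exact abs_le_jumpSum_of_mem hd hκ hΩ hΓ hR hv hz hzD
  · rw [nodeAvg, if_neg hzD]
    set I := Finset.univ.filter fun T : 𝒯.Elem => z ∈ hull T.1 with hI
    have hTI : T ∈ I := by simpa [hI] using subset_hull _ hz
    have hc : (0 : ℝ) < I.card := by exact_mod_cast Finset.card_pos.2 ⟨T, hTI⟩
    have e : v T z - (I.card : ℝ)⁻¹ * ∑ T' ∈ I, v T' z =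
        (I.card : ℝ)⁻¹ * ∑ T' ∈ I, (v T z - v T' z) := by
      rw [Finset.sum_sub_distrib, Finset.sum_const, nsmul_eq_mul, mul_sub,
        inv_mul_cancel_left₀ hc.ne']
    change |v T z - (I.card : ℝ)⁻¹ * ∑ T' ∈ I, v T' z| ≤ _
    rw [e, abs_mul, abs_of_pos (inv_pos.2 hc), inv_mul_le_iff₀ hc]
    refine (Finset.abs_sum_le_sum_abs _ _).trans ?_
    rw [← nsmul_eq_mul]
    refine Finset.sum_le_card_nsmul _ _ _ fun T' hT' => ?_
    have hzT' : z ∈ T'.1 := mem_of_mem_hull T'.2.1 hz (by simpa [hI] using hT')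
    have := abs_sub_le_jumpSum hd hκ hΩ ΓD hv.1 hz hzT'
    linarith [jumpSum_nonneg ΓD v T]

theorem sub_avgOp_apply (ΓD : Set (E d)) (v : 𝒯.L1) {T : 𝒯.Elem} {z : E d} (hz : z ∈ T.1) :
    (v - 𝒯.avgOp ΓD v) T z = v T z - 𝒯.nodeAvg ΓD v z := by
  classical
  have h : 𝒯.avgOp ΓD v T z = 𝒯.nodeAvg ΓD v z := by
    rw [avgOp, Finset.sum_apply, affineMap_sum_apply]
    simp only [Pi.smul_apply, AffineMap.coe_smul, nodal_apply_vertex _ hz, smul_eq_mul, mul_ite,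
      mul_one, mul_zero]
    rw [Finset.sum_ite_eq, if_pos (mem_nodes.2 ⟨T, hz⟩)]
  rw [← h]
  rfl

/-! ### Derivatives of affine functions on an element -/

theorem norm_iteratedFDeriv_one_affine (f : E d →ᵃ[ℝ] ℝ) (x : E d) :
    ‖iteratedFDeriv ℝ 1 f x‖ = ‖affGrad f‖ := by
  have h : fderiv ℝ f x = LinearMap.toContinuousLinearMap f.linear := by
    have : (f : E d → ℝ) = fun x => LinearMap.toContinuousLinearMap f.linear x + f 0 :=
      f.decomp
    rw [this, fderiv_add_const]
    exact ContinuousLinearMap.fderiv _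
  rw [norm_iteratedFDeriv_one, h, affGrad, LinearIsometryEquiv.norm_map]

theorem iteratedFDeriv_two_affine (f : E d →ᵃ[ℝ] ℝ) (x : E d) :
    iteratedFDeriv ℝ 2 f x = 0 := by
  have h : fderiv ℝ f = fun _ => LinearMap.toContinuousLinearMap f.linear := by
    funext x
    have : (f : E d → ℝ) = fun x => LinearMap.toContinuousLinearMap f.linear x + f 0 :=
      f.decomp
    rw [this, fderiv_add_const]
    exact ContinuousLinearMap.fderiv _
  rw [← norm_eq_zero, ← norm_iteratedFDeriv_fderiv, h, iteratedFDeriv_const_of_ne one_ne_zero]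
  simp

/-- The scaled derivatives of an affine function on a shape regular simplex are bounded by its
values at the vertices. -/
theorem meshSize_pow_mul_norm_iteratedFDeriv_le (hd : 1 ≤ d) (hκ : 𝒯.IsShapeRegular κ)
    {T : 𝒯.Elem} (f : E d →ᵃ[ℝ] ℝ) {B : ℝ} (hB : ∀ z ∈ T.1, |f z| ≤ B) {m : ℕ}
    (hm : m ∈ ({0, 1, 2} : Set ℕ)) {x : E d} (hx : x ∈ hull T.1) :
    meshSize T.1 ^ m * ‖iteratedFDeriv ℝ m f x‖ ≤ 2 * κ * B := by
  have hκ1 := one_le_shape hd hκ T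
  have hb : ∀ y ∈ hull T.1, |f y| ≤ B := fun y hy => abs_le_of_vertices f hB hy
  have hB0 : 0 ≤ B := (abs_nonneg _).trans (hb x hx)
  rcases hm with rfl | rfl | rfl
  · rw [pow_zero, one_mul, norm_iteratedFDeriv_zero, Real.norm_eq_abs]
    nlinarith [hb x hx]
  · rw [pow_one, norm_iteratedFDeriv_one_affine]
    have h1 := norm_affGrad_mul_inballDiam_le (nonempty T) f (M := 2 * B) fun y hy w hw => by
      linarith [(abs_le.1 (hb y hy)).2, (abs_le.1 (hb w hw)).1]
    calc meshSize T.1 * ‖affGrad f‖ ≤ κ * inballDiam T.1 * ‖affGrad f‖ := by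
          gcongr; exact hκ T
      _ = κ * (‖affGrad f‖ * inballDiam T.1) := by ring
      _ ≤ κ * (2 * B) := by gcongr
      _ = _ := by ring
  · rw [iteratedFDeriv_two_affine, norm_zero, mul_zero]
    positivity

end FEM.Triangulation

namespace FEM.Triangulation

variable {d : ℕ} {Ω : Set (E d)} {𝒯 : Triangulation Ω} {κ : ℝ}

/-! ### Means over elements, sides and patches -/

/-- Measurability is not needed, since the mean of a function which is not integrable is zero. -/
theorem setAverage_le_of_forall_le {α : Type*} [MeasurableSpace α] {μ : Measure α} {s : Set α}
    (hs : μ s < ⊤) {f : α → ℝ} {B : ℝ} (h0 : ∀ x ∈ s, 0 ≤ f x) (hB0 : 0 ≤ B)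
    (hB : ∀ x ∈ s, f x ≤ B) : ⨍ x in s, f x ∂μ ≤ B := by
  rw [setAverage_eq, smul_eq_mul]
  have h1 : ‖∫ x in s, f x ∂μ‖ ≤ B * μ.real s :=
    norm_setIntegral_le_of_norm_le_const hs fun x hx => by
      rw [Real.norm_of_nonneg (h0 x hx)]; exact hB x hx
  have h2 := (le_abs_self _).trans h1
  have h3 : 0 ≤ μ.real s := measureReal_nonneg
  calc (μ.real s)⁻¹ * ∫ x in s, f x ∂μ ≤ (μ.real s)⁻¹ * (B * μ.real s) := by gcongr
    _ = B * ((μ.real s)⁻¹ * μ.real s) := by ring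
    _ ≤ B * 1 := by gcongr; exact inv_mul_le_one
    _ = B := mul_one B

theorem setAverage_side_const (hd : 1 ≤ d) {ΓD : Set (E d)} {T : 𝒯.Elem} {S : Finset (E d)}
    (hS : S ∈ 𝒯.patchSides ΓD T) (c : ℝ) : ⨍ _x in hull S, c ∂μHE[d - 1] = c := by
  obtain ⟨T', hT', hc⟩ := mem_sides.1 (mem_patchSides.1 hS).1
  have h := euclideanHausdorffMeasure_hull_pos hd hc (affineIndependent_of_subset hT')
  exact setAverage_const h.1.ne' h.2.ne c

theorem brokenGrad_eq {v : 𝒯.L1} {T : 𝒯.Elem} {x : E d} (hx : x ∈ interior (hull T.1)) :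
    𝒯.brokenGrad v x = 𝒯.elemGrad v T := by
  rw [brokenGrad, Finset.sum_eq_single T]
  · exact indicator_of_mem hx _
  · intro T' _ hne
    exact indicator_of_notMem
      (fun h => hne (eq_of_mem_interior_hull h (interior_subset hx))) _
  · exact fun h => absurd (Finset.mem_univ T) h

theorem measurable_brokenGrad (v : 𝒯.L1) : Measurable (𝒯.brokenGrad v) :=
  Finset.measurable_sum _ fun _ _ =>
    measurable_const.indicator isOpen_interior.measurableSet

theorem norm_brokenGrad_le (v : 𝒯.L1) (x : E d) :
    ‖𝒯.brokenGrad v x‖ ≤ ∑ T : 𝒯.Elem, ‖𝒯.elemGrad v T‖ :=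
  (norm_sum_le _ _).trans (Finset.sum_le_sum fun _ _ => norm_indicator_le_norm_self _ _)

theorem isBounded_patch (T : 𝒯.Elem) : Bornology.IsBounded (𝒯.patch T) :=
  (Bornology.isBounded_biUnion (Set.toFinite _)).2 fun _ _ => isBounded_hull _

variable {φ : ℝ → ℝ} {a : ℝ}

theorem integrableOn_patch (h : NFun.IsNFunction φ) (ha : 0 ≤ a) (v : 𝒯.L1) (T : 𝒯.Elem) :
    IntegrableOn (fun x => NFun.shifted φ a (meshSize T.1 * ‖𝒯.brokenGrad v x‖))
      (𝒯.patch T) := by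
  have h0 := meshSize_nonneg T.1
  have hg : ∀ x, 0 ≤ meshSize T.1 * ‖𝒯.brokenGrad v x‖ := fun x => by positivity
  refine Measure.integrableOn_of_bounded (isBounded_patch T).measure_lt_top.ne
    (NFun.measurable_shifted_comp h ha
      (measurable_const.mul (measurable_brokenGrad v).norm) hg).aestronglyMeasurable
    (M := NFun.shifted φ a (meshSize T.1 * ∑ T : 𝒯.Elem, ‖𝒯.elemGrad v T‖)) ?_
  refine Eventually.of_forall fun x => ?_
  rw [Real.norm_of_nonneg (NFun.shifted_nonneg h ha (hg x))]
  have hle : meshSize T.1 * ‖𝒯.brokenGrad v x‖ ≤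
      meshSize T.1 * ∑ T : 𝒯.Elem, ‖𝒯.elemGrad v T‖ := by
    gcongr; exact norm_brokenGrad_le v x
  exact NFun.shifted_monotoneOn h ha (hg x) ((hg x).trans hle) hle

/-- The mean over the patch of `T` of the integrand of the upper bound. -/
abbrev patchMean (𝒯 : Triangulation Ω) (φ : ℝ → ℝ) (a : ℝ) (v : 𝒯.L1) (T : 𝒯.Elem) : ℝ :=
  ⨍ x in 𝒯.patch T, NFun.shifted φ a (meshSize T.1 * ‖𝒯.brokenGrad v x‖)

theorem patchMean_nonneg (h : NFun.IsNFunction φ) (ha : 0 ≤ a) (v : 𝒯.L1) (T : 𝒯.Elem) :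
    0 ≤ 𝒯.patchMean φ a v T :=
  integral_nonneg fun _ =>
    NFun.shifted_nonneg h ha (mul_nonneg (meshSize_nonneg _) (norm_nonneg _))

/-- A bound for the ratio of the volumes of the patch and of any of its elements. -/
def volumeRatio (d : ℕ) (κ : ℝ) : ℝ := ((1 + sizeRatio d κ) * (4 * κ * sizeRatio d κ)) ^ d

/-- The elements of a patch are comparable in size, so that the mean over the patch controls the
value on each of its elements. -/
theorem shifted_le_patchMean (hd : 2 ≤ d) (hκ : 𝒯.IsShapeRegular κ) (hΩ : IsLipschitzDomain Ω)
    (h : NFun.IsNFunction φ) (ha : 0 ≤ a) (v : 𝒯.L1) {T T' : 𝒯.Elem} (hT : Touches T' T) :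
    NFun.shifted φ a (meshSize T.1 * ‖𝒯.elemGrad v T'‖) ≤
      volumeRatio d κ * 𝒯.patchMean φ a v T := by
  have hd1 : 1 ≤ d := by omega
  have hκ0 : 0 < κ := one_pos.trans_le (one_le_shape hd1 hκ T)
  set Q := sizeRatio d κ with hQ
  have hQ0 : 0 < Q := by rw [hQ, sizeRatio]; positivity
  set hh := meshSize T.1 with hhdef
  have hh0 : 0 < hh := meshSize_pos hd1 T
  have hh'0 := meshSize_pos hd1 T'
  set ω := (volume : Measure (E d)).real (Metric.ball 0 1) with hω
  have hω0 : 0 < ω :=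
    ENNReal.toReal_pos (Metric.measure_ball_pos volume _ one_pos).ne'
      Metric.isBounded_ball.measure_lt_top.ne
  obtain ⟨x₀, hx₀⟩ := exists_closedBall_subset hd1 hκ T'
  set r := meshSize T'.1 / (4 * κ) with hr
  have hr0 : 0 < r := by positivity
  have hball : Metric.ball x₀ r ⊆ interior (hull T'.1) :=
    interior_maximal (Metric.ball_subset_closedBall.trans hx₀) Metric.isOpen_ball
  have hvol : (volume : Measure (E d)).real (Metric.ball x₀ r) = r ^ d * ω := by
    rw [measureReal_def, Measure.addHaar_ball_of_pos _ _ hr0, ENNReal.toReal_mul,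
      ENNReal.toReal_ofReal (by positivity), finrank_euclideanSpace_fin, hω, measureReal_def]
  obtain ⟨p, hp⟩ := nonempty T
  have hpatch : 𝒯.patch T ⊆ Metric.closedBall p ((1 + Q) * hh) := by
    intro x hx
    obtain ⟨T'', hT'', hxT⟩ := mem_patch.1 hx
    obtain ⟨z, hz'', hz⟩ := hT''.exists_vertex
    have e1 := norm_sub_le_meshSize hxT (subset_hull _ hz'')
    have e2 := norm_sub_le_meshSize (subset_hull _ hz) (subset_hull _ hp)
    have e3 := meshSize_le_of_common_vertex hd hκ hΩ hz'' hz
    rw [Metric.mem_closedBall, dist_eq_norm]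
    have := norm_sub_le_norm_sub_add_norm_sub x z p
    linarith
  have hpvol : (volume : Measure (E d)).real (𝒯.patch T) ≤ ((1 + Q) * hh) ^ d * ω := by
    have := Measure.addHaar_real_closedBall (volume : Measure (E d)) p
      (r := (1 + Q) * hh) (by positivity)
    rw [finrank_euclideanSpace_fin] at this
    rw [← this]
    exact measureReal_mono hpatch Metric.isBounded_closedBall.measure_lt_top.ne
  have hratio : ((1 + Q) * hh) ^ d ≤ volumeRatio d κ * r ^ d := by
    rw [volumeRatio, ← hQ, ← mul_pow]
    obtain ⟨z, hz', hz⟩ := hT.exists_vertex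
    have e3 : hh ≤ Q * meshSize T'.1 := meshSize_le_of_common_vertex hd hκ hΩ hz hz'
    have e4 : (1 + Q) * (4 * κ * Q) * r = (1 + Q) * (Q * meshSize T'.1) := by
      rw [hr]; field_simp
    rw [e4]
    gcongr
  set s := NFun.shifted φ a (hh * ‖𝒯.elemGrad v T'‖) with hs
  have hpos : ∀ x, 0 ≤ NFun.shifted φ a (hh * ‖𝒯.brokenGrad v x‖) := fun x =>
    NFun.shifted_nonneg h ha (by positivity)
  have hs0 : 0 ≤ s := NFun.shifted_nonneg h ha (by positivity)
  have hbp : Metric.ball x₀ r ⊆ 𝒯.patch T :=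
    hball.trans (interior_subset.trans (hull_subset_patch hT))
  have hint : r ^ d * ω * s ≤
      ∫ x in 𝒯.patch T, NFun.shifted φ a (hh * ‖𝒯.brokenGrad v x‖) := by
    calc r ^ d * ω * s = ∫ _x in Metric.ball x₀ r, s := by
          rw [setIntegral_const, hvol, smul_eq_mul]
      _ = ∫ x in Metric.ball x₀ r, NFun.shifted φ a (hh * ‖𝒯.brokenGrad v x‖) :=
          setIntegral_congr_fun Metric.isOpen_ball.measurableSet fun _ hx => by
            simp only [hs, brokenGrad_eq (v := v) (hball hx)]
      _ ≤ _ := setIntegral_mono_set (integrableOn_patch h ha v T)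
          (Eventually.of_forall hpos) hbp.eventuallyLE
  have hpm0 := patchMean_nonneg h ha v T
  have hP0 : 0 < (volume : Measure (E d)).real (𝒯.patch T) := by
    have : 0 < r ^ d * ω := by positivity
    rw [← hvol] at this
    exact this.trans_le (measureReal_mono hbp (isBounded_patch T).measure_lt_top.ne)
  have hmean : ∫ x in 𝒯.patch T, NFun.shifted φ a (hh * ‖𝒯.brokenGrad v x‖) =
      (volume : Measure (E d)).real (𝒯.patch T) * 𝒯.patchMean φ a v T := by
    rw [patchMean, setAverage_eq, smul_eq_mul, mul_inv_cancel_left₀ hP0.ne']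
  rw [hmean] at hint
  have hfin : r ^ d * ω * s ≤ r ^ d * ω * (volumeRatio d κ * 𝒯.patchMean φ a v T) := by
    calc r ^ d * ω * s ≤ _ := hint
      _ ≤ (volumeRatio d κ * r ^ d * ω) * 𝒯.patchMean φ a v T := by
          gcongr
          exact hpvol.trans (by gcongr)
      _ = _ := by ring
  exact le_of_mul_le_mul_left hfin (by positivity)

theorem meshSize_eq_zero_of_card_one {S : Finset (E d)} (hS : S.card = 1) : meshSize S = 0 := by
  obtain ⟨z, rfl⟩ := Finset.card_eq_one.1 hS
  simp [meshSize, hull]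

/-- The terms of the jump sum are controlled by the mean over the patch. In dimension one, where
touching elements need not be comparable in size, they vanish since sides are points. -/
theorem shifted_jump_le_patchMean (hd : 1 ≤ d) (hκ : 𝒯.IsShapeRegular κ)
    (hΩ : IsLipschitzDomain Ω) (h : NFun.IsNFunction φ) (h2 : NFun.IsDelta2 φ) {K : ℝ}
    (hK : NFun.shiftConst φ ≤ K) (hK1 : 0 ≤ K) (ha : 0 ≤ a) (v : 𝒯.L1) {ΓD : Set (E d)}
    {T : 𝒯.Elem} {S : Finset (E d)} (hS : S ∈ 𝒯.patchSides ΓD T) {l : ℕ}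
    (hl : 2 * sizeRatio d κ ≤ 2 ^ l) :
    NFun.shifted φ a (meshSize S * ‖𝒯.jump (𝒯.elemGrad v) S‖) ≤
      K ^ l * (volumeRatio d κ * 𝒯.patchMean φ a v T) := by
  obtain ⟨T₀, hT₀, hc⟩ := mem_sides.1 (mem_patchSides.1 hS).1
  have hκ0 : 0 < κ := one_pos.trans_le (one_le_shape hd hκ T)
  have hQ0 : 0 < sizeRatio d κ := by rw [sizeRatio]; positivity
  have hV0 : 0 < volumeRatio d κ := by rw [volumeRatio]; positivity
  rcases hd.eq_or_lt with rfl | hd2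
  · rw [meshSize_eq_zero_of_card_one hc, zero_mul, NFun.shifted_zero]
    have := patchMean_nonneg h ha v T
    positivity
  obtain ⟨T', T'', h', h'', hle⟩ := norm_jump_le (𝒯.elemGrad v) hT₀
  obtain ⟨T₁, hT₁, hle₁⟩ : ∃ T₁ : 𝒯.Elem, S ⊆ T₁.1 ∧
      ‖𝒯.jump (𝒯.elemGrad v) S‖ ≤ 2 * ‖𝒯.elemGrad v T₁‖ := by
    rcases le_total ‖𝒯.elemGrad v T'‖ ‖𝒯.elemGrad v T''‖ with hl | hl
    · exact ⟨T'', h'', by linarith⟩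
    · exact ⟨T', h', by linarith⟩
  have ht := touches_of_mem_patchSides hS hT₁
  obtain ⟨z, hz₁, hz⟩ := ht.exists_vertex
  have hsize : meshSize S ≤ sizeRatio d κ * meshSize T.1 :=
    (meshSize_mono hT₁).trans (meshSize_le_of_common_vertex hd2 hκ hΩ hz₁ hz)
  have h0 := meshSize_nonneg S
  have h0T := meshSize_nonneg T.1
  have hb : meshSize S * ‖𝒯.jump (𝒯.elemGrad v) S‖ ≤
      2 ^ l * (meshSize T.1 * ‖𝒯.elemGrad v T₁‖) := by
    calc meshSize S * ‖𝒯.jump (𝒯.elemGrad v) S‖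
        ≤ (sizeRatio d κ * meshSize T.1) * (2 * ‖𝒯.elemGrad v T₁‖) := by gcongr
      _ = 2 * sizeRatio d κ * (meshSize T.1 * ‖𝒯.elemGrad v T₁‖) := by ring
      _ ≤ _ := by gcongr
  have hb0 : 0 ≤ meshSize S * ‖𝒯.jump (𝒯.elemGrad v) S‖ := by positivity
  calc NFun.shifted φ a (meshSize S * ‖𝒯.jump (𝒯.elemGrad v) S‖)
      ≤ NFun.shifted φ a (2 ^ l * (meshSize T.1 * ‖𝒯.elemGrad v T₁‖)) :=
        NFun.shifted_monotoneOn h ha hb0 (hb0.trans hb) hb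
    _ ≤ K ^ l * NFun.shifted φ a (meshSize T.1 * ‖𝒯.elemGrad v T₁‖) :=
        NFun.shifted_two_pow_mul_le h h2 hK hK1 ha (by positivity) l
    _ ≤ _ := by
        gcongr
        exact shifted_le_patchMean hd2 hκ hΩ h ha v ht

end FEM.Triangulation

end

/-! ### The estimate for node averaging -/

open FEM.Triangulation in
theorem mainTheorem9 (d : ℕ) (hd : 1 ≤ d) (κ K : ℝ) :
    ∃ c c' : ℝ, 0 < c ∧ 0 < c' ∧
      ∀ φ : ℝ → ℝ, NFun.IsNFunction φ → NFun.IsDelta2 φ → NFun.IsNabla2 φ →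
        NFun.shiftConst φ ≤ K →
      ∀ Ω ΓD : Set (FEM.E d), FEM.IsLipschitzDomain Ω → ΓD ⊆ frontier Ω → IsClosed ΓD →
      ∀ 𝒯 : FEM.Triangulation Ω, 𝒯.IsShapeRegular κ → 𝒯.Resolves ΓD →
      ∀ v : 𝒯.L1, 𝒯.IsCRD ΓD v →
      ∀ m ∈ ({0, 1, 2} : Set ℕ), ∀ a : ℝ, 0 ≤ a → ∀ T : 𝒯.Elem,
        (⨍ x in FEM.Triangulation.hull T.1,
            NFun.shifted φ a (FEM.Triangulation.meshSize T.1 ^ m *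
              ‖iteratedFDeriv ℝ m (⇑((v - 𝒯.avgOp ΓD v) T) : FEM.E d → ℝ) x‖))
          ≤ c * ∑ S ∈ 𝒯.patchSides ΓD T, ⨍ _x in FEM.Triangulation.hull S,
              NFun.shifted φ a (FEM.Triangulation.meshSize S * ‖𝒯.jump (𝒯.elemGrad v) S‖) ∂μHE[d - 1] ∧
        c * ∑ S ∈ 𝒯.patchSides ΓD T, ⨍ _x in FEM.Triangulation.hull S,
              NFun.shifted φ a (FEM.Triangulation.meshSize S * ‖𝒯.jump (𝒯.elemGrad v) S‖) ∂μHE[d - 1]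
          ≤ c' * ⨍ x in 𝒯.patch T,
              NFun.shifted φ a (FEM.Triangulation.meshSize T.1 * ‖𝒯.brokenGrad v x‖) := by
  -- A triangulation with an element cannot be shape regular with a constant smaller than one.
  by_cases hκ1 : 1 ≤ κ
  swap
  · refine ⟨1, 1, one_pos, one_pos, ?_⟩
    intro φ _ _ _ _ Ω ΓD _ _ _ 𝒯 hκ _ v _ m _ a _ T
    exact absurd (one_le_shape hd hκ T) hκ1
  -- `A` times the jump sum bounds the argument of `φ_a` on the left-hand side; `2 ^ k` also absorbs
  -- the number of sides, and `2 ^ l` the size ratios in a patch.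
  set K' := max K 1 with hK'
  have hK'1 : 1 ≤ K' := le_max_right _ _
  have hK'0 : 0 < K' := one_pos.trans_le hK'1
  set A : ℝ := 2 * κ * (starBound d κ + 1) with hA
  have hA0 : 0 ≤ A := by positivity
  obtain ⟨k, hk⟩ := pow_unbounded_of_one_lt (A * sideBound d κ) (one_lt_two (α := ℝ))
  obtain ⟨l, hl⟩ := pow_unbounded_of_one_lt (2 * sizeRatio d κ) (one_lt_two (α := ℝ))
  have hκ0 : 0 < κ := one_pos.trans_le hκ1
  have hQ0 : 0 < sizeRatio d κ := by rw [sizeRatio]; positivity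
  have hV0 : 0 < volumeRatio d κ := by rw [volumeRatio]; positivity
  refine ⟨K' ^ k, K' ^ k * (sideBound d κ * (K' ^ l * volumeRatio d κ)) + 1, by positivity,
    by positivity, ?_⟩
  intro φ hφ hφ2 _ hφK Ω ΓD hΩ hΓ _ 𝒯 hκ hR v hv m hm a ha T
  have hφK' : NFun.shiftConst φ ≤ K' := hφK.trans (le_max_left _ _)
  have hcard : ((𝒯.patchSides ΓD T).card : ℝ) ≤ sideBound d κ := by
    exact_mod_cast card_patchSides_le hd hκ ΓD T
  have ht : ∀ S : Finset (FEM.E d), 0 ≤ meshSize S * ‖𝒯.jump (𝒯.elemGrad v) S‖ :=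
    fun S => mul_nonneg (meshSize_nonneg S) (norm_nonneg _)
  rw [Finset.sum_congr rfl fun S hS => setAverage_side_const hd hS _]
  have hsum0 : 0 ≤ ∑ S ∈ 𝒯.patchSides ΓD T,
      NFun.shifted φ a (meshSize S * ‖𝒯.jump (𝒯.elemGrad v) S‖) :=
    Finset.sum_nonneg fun S _ => NFun.shifted_nonneg hφ ha (ht S)
  constructor
  · have hT0 := meshSize_nonneg T.1
    refine setAverage_le_of_forall_le (isBounded_hull T.1).measure_lt_top
      (fun x _ => NFun.shifted_nonneg hφ ha (by positivity)) (by positivity) fun x hx => ?_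
    have h1 := meshSize_pow_mul_norm_iteratedFDeriv_le hd hκ ((v - 𝒯.avgOp ΓD v) T)
      (B := (starBound d κ + 1) * 𝒯.jumpSum ΓD v T) (fun z hz => by
        rw [sub_avgOp_apply ΓD v hz]
        exact abs_sub_nodeAvg_le hd hκ hΩ hΓ hR hv hz) hm hx
    rw [← mul_assoc] at h1
    refine (NFun.shifted_monotoneOn hφ ha (mem_Ici.2 (by positivity))
      (mem_Ici.2 (mul_nonneg hA0 (jumpSum_nonneg ΓD v T))) h1).trans ?_
    exact NFun.shifted_mul_sum_le hφ hφ2 hφK' hK'0.le ha _ (fun S _ => ht S) hA0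
      ((mul_le_mul_of_nonneg_left hcard hA0).trans hk.le)
  · have hpm := patchMean_nonneg hφ ha v T
    have h1 : ∑ S ∈ 𝒯.patchSides ΓD T,
        NFun.shifted φ a (meshSize S * ‖𝒯.jump (𝒯.elemGrad v) S‖) ≤
        sideBound d κ * (K' ^ l * (volumeRatio d κ * 𝒯.patchMean φ a v T)) := by
      refine (Finset.sum_le_card_nsmul _ _ _ fun S hS =>
        shifted_jump_le_patchMean hd hκ hΩ hφ hφ2 hφK' hK'0.le ha v hS hl.le).trans ?_
      rw [nsmul_eq_mul]
      gcongr
    calc _ ≤ K' ^ k * (sideBound d κ * (K' ^ l * (volumeRatio d κ * 𝒯.patchMean φ a v T))) := by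
          gcongr
      _ = K' ^ k * (sideBound d κ * (K' ^ l * volumeRatio d κ)) * 𝒯.patchMean φ a v T := by ring
      _ ≤ (K' ^ k * (sideBound d κ * (K' ^ l * volumeRatio d κ)) + 1) * 𝒯.patchMean φ a v T := by
          gcongr
          linarith
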